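/- Let $\mathbb K\in\{\mathbb R,\mathbb C\}$ and let $X$ be a $\mathbb K$-Banach space. Let $\mathcal L(X)$ be the Banach space of bounded linear operators on $X$, and let $\mathcal I(X)=\{Q\in\mathcal L(X)\setminus\{0,I\}: Q^2=Q\}$, with the norm topology. Let $\mathcal G(X)$ be the set of non-zero proper complemented subspaces of $X$ (for $\dim X\le 1$ these sets are empty), and write $F\perp E$ if $E,F\in\mathcal G(X)$ are complements of each other. Equip $\mathcal G(X)$ with the topology and the analytic atlas of the Grassmann manifold: for $E_0\perp F_0$ put $q_{E_0,F_0}(T)=(I+T)(E_0)$ for $T\in\mathcal L(E_0,F_0)$; a set is open if and only if its preimages under all the maps $q_{E_0,F_0}$ are open, and the charts are the maps $q_{E_0,F_0}^{-1}:\{E: E\perp F_0\}\to\mathcal L(E_0,F_0)$. Let $$\mathcal P=\{(E,F)\in\mathcal G(X)\times\mathcal G(X): F\perp E\}$$ with the topology $\mathcal T$ induced from $\mathcal G(X)\times\mathcal G(X)$, let $\kappa_1:\mathcal P\to\mathcal G(X)$ be $\kappa_1(E,F)=E$, and for $(E,F)\in\mathcal P$ let $Q_E^F\in\mathcal I(X)$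 be the idempotent with range $E$ and kernel $F$. Definition. An affine-Banach subspace of a Banach space is a translate of a closed linear subspace; the space $\mathcal A(A,A')$ of continuous affine maps between two of them has the analytic structure given by the coordinates $f\mapsto(f(a_0)-a_0',\ \text{linear part of } f)$, for $a_0\in A$, $a_0'\in A'$. Let $\Upsilon,\Omega$ be (Hausdorff) analytic $\mathbb K$-Banach manifolds, $\kappa:\Upsilon\to\Omega$ an analytic surjection, and let each fiber $\Upsilon_\omega=\kappa^{-1}(\omega)$ be identified, by a homeomorphism, with an affine-Banach subspace of a Banach space. Then $\kappa$ is a *locally trivial analytic affine-Banach bundle* if there are, for each $\omega_0\in\Omega$, an open neighborhood $V_{\omega_0}$ of $\omega_0$ and a bi-analytic bijection $\Theta_{\omega_0}:V_{\omega_0}\times\Upsilon_{\omega_0}\to\kappa^{-1}(V_{\omega_0})$ restricting, for each $\omega\in V_{\omega_0}$, to an affine map of $\{\omega\}\times\Upsilon_{\omega_0}$ onto $\Upsilon_\omega$, such that for all $\omega_1,\omega_2$ with $V_{\omega_1}\cap V_{\omega_2}\ne\emptyset$ the map $$V_{\omega_1}\cap V_{\omega_2}\to\mathcal A(\Upsilon_{\omega_1},\Upsilon_{\omega_2}),\qquad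 \omega\mapsto\bigl(x\mapsto \Pi_2(\Theta_{\omega_2}^{-1}(\Theta_{\omega_1}(\omega,x)))\bigr)$$ is well defined and analytic, where $\Pi_2$ is the projection onto the second coordinate. Theorem. The map $(E,F)\mapsto Q_E^F$ is a homeomorphism from $(\mathcal P,\mathcal T)$ onto $\mathcal I(X)$. Moreover there is an analytic $\mathbb K$-Banach manifold structure on $\mathcal P$, compatible with $\mathcal T$, for which $(E,F)\mapsto Q_E^F$ is an analytic immersion into $\mathcal L(X)$ (that is, analytic, with derivative at each point injective and with complemented range), and for which $\kappa_1:\mathcal P\to\mathcal G(X)$ is a locally trivial analytic affine-Banach bundle, where each fiber $\kappa_1^{-1}(E)$ is identified, by $(E,F)\mapsto Q_E^F$, with an affine-Banach subspace of $\mathcal L(X)$. -/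

import Mathlib

open Set Topology

universe u v

noncomputable section

/-! ### Analytic Banach manifolds, with model spaces that may vary from chart to chart -/

/-- A chart on `M` with values in a normed space over `𝕜`: a bijection between a subset `source`
of `M` and a subset `target` of the model space. Openness, continuity, completeness of the model
and analyticity of the coordinate changes are required in `IsBanachManifold`. -/
structure BanachChart (𝕜 : Type*) [RCLike 𝕜] (M : Type*) where
  Model : Type*
  [normedAddCommGroup : NormedAddCommGroup Model]
  [normedSpace : NormedSpace 𝕜 Model]
  toPartialEquiv : PartialEquiv M Model

attribute [instance] BanachChart.normedAddCommGroup BanachChart.normedSpace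

/-- `A` is an analytic atlas of the topological space `M`, which makes `M` a (Hausdorff) analytic
`𝕜`-Banach manifold whose topology is the given one. -/
structure IsBanachManifold {𝕜 : Type*} [RCLike 𝕜] {M : Type*} [TopologicalSpace M]
    (A : Set (BanachChart 𝕜 M)) : Prop where
  t2 : T2Space M
  complete : ∀ c ∈ A, CompleteSpace c.Model
  cover : ∀ x : M, ∃ c ∈ A, x ∈ c.toPartialEquiv.source
  isOpen_source : ∀ c ∈ A, IsOpen c.toPartialEquiv.source
  isOpen_target : ∀ c ∈ A, IsOpen c.toPartialEquiv.target
  continuousOn : ∀ c ∈ A, ContinuousOn c.toPartialEquiv c.toPartialEquiv.source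
  continuousOn_symm : ∀ c ∈ A, ContinuousOn c.toPartialEquiv.symm c.toPartialEquiv.target
  analytic : ∀ c ∈ A, ∀ d ∈ A,
    AnalyticOnNhd 𝕜 (fun z => d.toPartialEquiv (c.toPartialEquiv.symm z))
      (c.toPartialEquiv.symm.trans d.toPartialEquiv).source

/-- The map `f` is analytic on the open set `s`, with respect to atlases `A` and `B`. -/
def IsAnalyticOn {𝕜 : Type*} [RCLike 𝕜] {M N : Type*} [TopologicalSpace M] [TopologicalSpace N]
    (A : Set (BanachChart 𝕜 M)) (B : Set (BanachChart 𝕜 N)) (f : M → N) (s : Set M) : Prop :=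
  ContinuousOn f s ∧
    ∀ x ∈ s, ∀ c ∈ A, ∀ d ∈ B, x ∈ c.toPartialEquiv.source → f x ∈ d.toPartialEquiv.source →
      AnalyticAt 𝕜 (fun z => d.toPartialEquiv (f (c.toPartialEquiv.symm z))) (c.toPartialEquiv x)

/-- The standard atlas of a normed space, consisting of the identity map alone. -/
def vectorAtlas (𝕜 : Type*) [RCLike 𝕜] (Z : Type*) [NormedAddCommGroup Z] [NormedSpace 𝕜 Z] :
    Set (BanachChart 𝕜 Z) :=
  {⟨Z, PartialEquiv.refl Z⟩}

/-- The product of two atlases. -/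
def prodAtlas {𝕜 : Type*} [RCLike 𝕜] {M N : Type*}
    (A : Set (BanachChart 𝕜 M)) (B : Set (BanachChart 𝕜 N)) : Set (BanachChart 𝕜 (M × N)) :=
  {e | ∃ c ∈ A, ∃ d ∈ B, e = ⟨c.Model × d.Model, c.toPartialEquiv.prod d.toPartialEquiv⟩}

/-- `f` is an analytic immersion of the manifold `M` with atlas `A` in the Banach space `Y`: it is
analytic, and its derivative at each point is injective with complemented range. (As coordinate
changes are bi-analytic, it does not matter in which chart the derivative is taken.) -/
def IsAnalyticImmersion {𝕜 : Type*} [RCLike 𝕜] {M : Type*} [TopologicalSpace M]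
    {Y : Type*} [NormedAddCommGroup Y] [NormedSpace 𝕜 Y]
    (A : Set (BanachChart 𝕜 M)) (f : M → Y) : Prop :=
  IsAnalyticOn A (vectorAtlas 𝕜 Y) f univ ∧
    ∀ x : M, ∃ c ∈ A, x ∈ c.toPartialEquiv.source ∧
      Function.Injective
        (fderiv 𝕜 (fun z => f (c.toPartialEquiv.symm z)) (c.toPartialEquiv x)) ∧
      (LinearMap.range
        (fderiv 𝕜 (fun z => f (c.toPartialEquiv.symm z)) (c.toPartialEquiv x) :
          c.Model →ₗ[𝕜] Y)).ClosedComplemented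

/-! ### Affine-Banach subspaces -/

/-- An affine-Banach subspace of a Banach space: a translate of a closed linear subspace. -/
structure AffineBanachSubspace (𝕜 : Type*) [RCLike 𝕜] (Y : Type*) [NormedAddCommGroup Y]
    [NormedSpace 𝕜 Y] where
  space : AffineSubspace 𝕜 Y
  nonempty : Nonempty space
  isClosed : IsClosed (space : Set Y)

instance {𝕜 : Type*} [RCLike 𝕜] {Y : Type*} [NormedAddCommGroup Y] [NormedSpace 𝕜 Y]
    (S : AffineBanachSubspace 𝕜 Y) : Nonempty S.space := S.nonempty

/-- The standard atlas of an affine-Banach subspace `S`: the charts `a ↦ a - a₀`, for `a₀ ∈ S`,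
with values in the direction of `S`. -/
def affineAtlas {𝕜 : Type*} [RCLike 𝕜] {Y : Type*} [NormedAddCommGroup Y] [NormedSpace 𝕜 Y]
    (S : AffineBanachSubspace 𝕜 Y) : Set (BanachChart 𝕜 S.space) :=
  Set.range fun a₀ : S.space => ⟨S.space.direction, (Equiv.vaddConst a₀).symm.toPartialEquiv⟩

/-- The coordinate `f ↦ (f a₀ - b₀, linear part of f)` on the space of continuous affine maps from
`S` to `S'`, which identifies it with a Banach space and so defines its analytic structure. -/
def affineMapCoord {𝕜 : Type*} [RCLike 𝕜] {Y Y' : Type*} [NormedAddCommGroup Y]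
    [NormedSpace 𝕜 Y] [NormedAddCommGroup Y'] [NormedSpace 𝕜 Y']
    {S : AffineBanachSubspace 𝕜 Y} {S' : AffineBanachSubspace 𝕜 Y'} (a₀ : S.space) (b₀ : S'.space)
    (f : S.space →ᴬ[𝕜] S'.space) :
    S'.space.direction × (S.space.direction →L[𝕜] S'.space.direction) :=
  (f a₀ -ᵥ b₀, f.contLinear)

/-! ### Affine-Banach bundles -/

/-- Affine-Banach space structures on the fibers of `κ`: the fiber over `ω` is identified, by a
homeomorphism, with an affine-Banach subspace of `Y ω`. -/
structure AffineBanachFibers (𝕜 : Type*) [RCLike 𝕜] {Υ Ω : Type*} [TopologicalSpace Υ]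
    (Y : Ω → Type*) [∀ ω, NormedAddCommGroup (Y ω)] [∀ ω, NormedSpace 𝕜 (Y ω)] (κ : Υ → Ω) where
  fiber : ∀ ω, AffineBanachSubspace 𝕜 (Y ω)
  homeo : ∀ ω, (κ ⁻¹' {ω}) ≃ₜ (fiber ω).space

/-- With the atlases `A` on `Υ` and `B` on `Ω`, and the affine-Banach space structures `S` on the
fibers, `κ : Υ → Ω` is a locally trivial analytic affine-Banach bundle.

The local trivialization `Θ ω₀` is a bi-analytic map of `V ω₀ ×` (fiber over `ω₀`) onto
`κ ⁻¹' (V ω₀)` whose restriction to `{ω} ×` (fiber over `ω₀`) is an affine map to the fiber over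
`ω` (it is onto that fiber because `Θ ω₀` is onto `κ ⁻¹' (V ω₀)`). Fibers are written in terms of
the affine-Banach subspaces with which they are identified. -/
structure IsAnalyticAffineBanachBundle {𝕜 : Type*} [RCLike 𝕜] {Υ Ω : Type*}
    [TopologicalSpace Υ] [TopologicalSpace Ω]
    {Y : Ω → Type*} [∀ ω, NormedAddCommGroup (Y ω)] [∀ ω, NormedSpace 𝕜 (Y ω)]
    (A : Set (BanachChart 𝕜 Υ)) (B : Set (BanachChart 𝕜 Ω)) (κ : Υ → Ω)
    (S : AffineBanachFibers 𝕜 Y κ) : Prop where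
  total : IsBanachManifold A
  base : IsBanachManifold B
  surjective : Function.Surjective κ
  analytic : IsAnalyticOn A B κ univ
  complete : ∀ ω, CompleteSpace (Y ω)
  locallyTrivial :
    ∃ (V : Ω → Set Ω) (Θ : ∀ ω₀, OpenPartialHomeomorph (Ω × (S.fiber ω₀).space) Υ),
      (∀ ω₀, IsOpen (V ω₀) ∧ ω₀ ∈ V ω₀ ∧
        (Θ ω₀).source = V ω₀ ×ˢ univ ∧ (Θ ω₀).target = κ ⁻¹' (V ω₀) ∧
        IsAnalyticOn (prodAtlas B (affineAtlas (S.fiber ω₀))) A (Θ ω₀) (Θ ω₀).source ∧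
        IsAnalyticOn A (prodAtlas B (affineAtlas (S.fiber ω₀))) (Θ ω₀).symm (Θ ω₀).target ∧
        ∀ ω ∈ V ω₀, ∃ g : (S.fiber ω₀).space →ᵃ[𝕜] (S.fiber ω).space,
          ∀ a, Θ ω₀ (ω, a) = ((S.homeo ω).symm (g a) : Υ)) ∧
      ∀ ω₁ ω₂, ∃ φ : Ω → ((S.fiber ω₁).space →ᴬ[𝕜] (S.fiber ω₂).space),
        (∀ ω ∈ V ω₁ ∩ V ω₂, ∀ a, φ ω a = ((Θ ω₂).symm (Θ ω₁ (ω, a))).2) ∧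
        ∀ a₀ b₀, IsAnalyticOn B (vectorAtlas 𝕜 _) (fun ω => affineMapCoord a₀ b₀ (φ ω))
          (V ω₁ ∩ V ω₂)

/-! ### The Grassmann manifold -/

/-- The set `𝒢(X)` of non-zero proper complemented subspaces of `X`. -/
@[ext]
structure BanachGrassmannian (𝕜 : Type*) [RCLike 𝕜] (X : Type*) [NormedAddCommGroup X]
    [NormedSpace 𝕜 X] where
  toSubmodule : Submodule 𝕜 X
  closedComplemented : toSubmodule.ClosedComplemented
  ne_bot : toSubmodule ≠ ⊥
  ne_top : toSubmodule ≠ ⊤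

/-- The pairs `(E, F)` in `𝒢(X) × 𝒢(X)` such that `F` is a complement of `E`. -/
@[ext]
structure ComplementaryPair (𝕜 : Type*) [RCLike 𝕜] (X : Type*) [NormedAddCommGroup X]
    [NormedSpace 𝕜 X] where
  fst : BanachGrassmannian 𝕜 X
  snd : BanachGrassmannian 𝕜 X
  isCompl : IsCompl fst.toSubmodule snd.toSubmodule

section Grassmannian

variable {𝕜 : Type*} [RCLike 𝕜] {X : Type*} [NormedAddCommGroup X] [NormedSpace 𝕜 X]

namespace ComplementaryPair

theorem isTopCompl [CompleteSpace X] {E F : BanachGrassmannian 𝕜 X} (h : IsCompl E.toSubmodule F.toSubmodule) :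
    Submodule.IsTopCompl E.toSubmodule F.toSubmodule :=
  Submodule.isTopCompl_iff_isCompl_isClosed.2 ⟨h, E.closedComplemented.isClosed, F.closedComplemented.isClosed⟩

/-- The subspace `(I + T)(E)`, for `p = (E, F)` and `T : E → F`. -/
def graph (p : ComplementaryPair 𝕜 X) (T : p.fst.toSubmodule →L[𝕜] p.snd.toSubmodule) : Submodule 𝕜 X :=
  LinearMap.range (p.fst.toSubmodule.subtype + p.snd.toSubmodule.subtype ∘ₗ (T : p.fst.toSubmodule →ₗ[𝕜] p.snd.toSubmodule))

theorem mem_graph (p : ComplementaryPair 𝕜 X) (T : p.fst.toSubmodule →L[𝕜] p.snd.toSubmodule) (x : X) :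
    x ∈ p.graph T ↔ ∃ e : p.fst.toSubmodule, (e : X) + T e = x := by
  simp [graph]

theorem isCompl_graph (p : ComplementaryPair 𝕜 X) (T : p.fst.toSubmodule →L[𝕜] p.snd.toSubmodule) :
    IsCompl (p.graph T) p.snd.toSubmodule := by
  have hp : IsCompl p.fst.toSubmodule p.snd.toSubmodule := p.isCompl
  constructor
  · rw [Submodule.disjoint_def]
    intro x hx hF
    obtain ⟨e, rfl⟩ := (p.mem_graph T x).1 hx
    have he : (e : X) ∈ p.snd.toSubmodule := by simpa using p.snd.toSubmodule.sub_mem hF (T e).2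
    have h0 : e = 0 := Subtype.ext (Submodule.disjoint_def.1 hp.disjoint _ e.2 he)
    simp [h0]
  · rw [codisjoint_iff, Submodule.eq_top_iff']
    intro x
    have hx : x ∈ p.fst.toSubmodule ⊔ p.snd.toSubmodule := by rw [hp.sup_eq_top]; trivial
    obtain ⟨e, he, f, hf, rfl⟩ := Submodule.mem_sup.1 hx
    refine Submodule.mem_sup.2 ⟨e + T ⟨e, he⟩, (p.mem_graph T _).2 ⟨⟨e, he⟩, rfl⟩,
      f - T ⟨e, he⟩, p.snd.toSubmodule.sub_mem hf (T ⟨e, he⟩).2, by abel⟩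

theorem closedComplemented_graph [CompleteSpace X] (p : ComplementaryPair 𝕜 X)
    (T : p.fst.toSubmodule →L[𝕜] p.snd.toSubmodule) : (p.graph T).ClosedComplemented := by
  have hp : Submodule.IsTopCompl p.fst.toSubmodule p.snd.toSubmodule := isTopCompl p.isCompl
  let P := p.fst.toSubmodule.projectionOntoL p.snd.toSubmodule hp
  let f : X →L[𝕜] X := (p.fst.toSubmodule.subtypeL + p.snd.toSubmodule.subtypeL ∘L T) ∘L P
  refine ⟨f.codRestrict (p.graph T) fun x => (p.mem_graph T _).2 ⟨P x, rfl⟩, ?_⟩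
  rintro ⟨x, hx⟩
  obtain ⟨e, rfl⟩ := (p.mem_graph T x).1 hx
  have hP : P ((e : X) + T e) = e := by
    simp only [P, map_add, Submodule.projectionOntoL_apply_left,
      Submodule.projectionOntoL_apply_right, add_zero]
  apply Subtype.ext
  change ((P ((e : X) + T e) : X) + (T (P ((e : X) + T e)) : X)) = (e : X) + T e
  rw [hP]

/-- For `p = (E, F)`, the map `q_{E,F} : 𝓛(E, F) → 𝒢(X)`, `T ↦ (I + T)(E)`. -/
def graphMap [CompleteSpace X] (p : ComplementaryPair 𝕜 X) (T : p.fst.toSubmodule →L[𝕜] p.snd.toSubmodule) :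
    BanachGrassmannian 𝕜 X :=
  ⟨p.graph T, p.closedComplemented_graph T,
    fun h => p.snd.ne_top (by simpa [h] using (p.isCompl_graph T).sup_eq_top),
    fun h => p.snd.ne_bot (by simpa [h] using (p.isCompl_graph T).inf_eq_bot)⟩

/-- `q_{E,F}` is a bijection from `𝓛(E, F)` onto the set of complements of `F`. -/
theorem bijOn_graphMap [CompleteSpace X] (p : ComplementaryPair 𝕜 X) :
    BijOn p.graphMap univ {E | IsCompl E.toSubmodule p.snd.toSubmodule} := by
  have hp : IsCompl p.fst.toSubmodule p.snd.toSubmodule := p.isCompl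
  refine ⟨fun T _ => p.isCompl_graph T, ?_, ?_⟩
  · intro T _ T' _ h
    have h' : p.graph T = p.graph T' := congrArg BanachGrassmannian.toSubmodule h
    ext e
    have he : (e : X) + T e ∈ p.graph T' := h' ▸ (p.mem_graph T _).2 ⟨e, rfl⟩
    obtain ⟨e', he'⟩ := (p.mem_graph T' _).1 he
    have h1 : ((e' - e : p.fst.toSubmodule) : X) = ((T e - T' e' : p.snd.toSubmodule) : X) := by
      push_cast
      rw [sub_eq_sub_iff_add_eq_add, he', add_comm]
    have h2 : ((e' - e : p.fst.toSubmodule) : X) = 0 :=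
      Submodule.disjoint_def.1 hp.disjoint _ (e' - e).2 (h1 ▸ (T e - T' e').2)
    have h3 : e' = e := sub_eq_zero.1 (Subtype.ext h2)
    subst h3
    exact (add_left_cancel he').symm
  · intro E hE
    have hE : IsCompl E.toSubmodule p.snd.toSubmodule := hE
    let Q := E.toSubmodule.projectionL p.snd.toSubmodule (isTopCompl hE)
    have hmem : ∀ e : p.fst.toSubmodule, Q (e : X) - e ∈ p.snd.toSubmodule := by
      intro e
      rw [← Submodule.projectionL_apply_eq_zero_iff (isTopCompl hE), map_sub]
      have : Q (Q (e : X)) = Q e :=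
        (Submodule.projectionL_eq_self_iff (isTopCompl hE) _).2
          (Submodule.projectionL_apply_mem _ _)
      exact sub_eq_zero.2 this
    let T : p.fst.toSubmodule →L[𝕜] p.snd.toSubmodule :=
      (Q ∘L p.fst.toSubmodule.subtypeL - p.fst.toSubmodule.subtypeL).codRestrict p.snd.toSubmodule hmem
    have hT : ∀ e : p.fst.toSubmodule, (e : X) + T e = Q e := by
      intro e
      change (e : X) + (Q (e : X) - e) = Q e
      abel
    refine ⟨T, mem_univ _, BanachGrassmannian.ext ?_⟩
    change p.graph T = E.toSubmodule
    apply le_antisymm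
    · intro x hx
      obtain ⟨e, rfl⟩ := (p.mem_graph T x).1 hx
      rw [hT]
      exact Submodule.projectionL_apply_mem _ _
    · intro x hx
      have hx' : x ∈ p.fst.toSubmodule ⊔ p.snd.toSubmodule := by rw [hp.sup_eq_top]; trivial
      obtain ⟨e, he, f, hf, rfl⟩ := Submodule.mem_sup.1 hx'
      refine (p.mem_graph T _).2 ⟨⟨e, he⟩, ?_⟩
      rw [hT]
      have h1 : Q (e + f) = e + f := (Submodule.projectionL_eq_self_iff _ _).2 hx
      have h2 : Q f = 0 := (Submodule.projectionL_apply_eq_zero_iff _).2 hf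
      rw [map_add, h2, add_zero] at h1
      exact h1

end ComplementaryPair

open ComplementaryPair

variable [CompleteSpace X]

/-- The topology of `𝒢(X)`: a set is open if and only if its preimages under all the maps
`q_{E,F} : 𝓛(E, F) → 𝒢(X)` are open. -/
instance : TopologicalSpace (BanachGrassmannian 𝕜 X) :=
  ⨆ p : ComplementaryPair 𝕜 X, TopologicalSpace.coinduced p.graphMap inferInstance

/-- Pairs of complementary subspaces carry the topology induced from `𝒢(X) × 𝒢(X)`. -/
instance : TopologicalSpace (ComplementaryPair 𝕜 X) :=
  TopologicalSpace.induced (fun p => (p.fst, p.snd)) inferInstance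

variable (𝕜 X) in
/-- The standard atlas of the Grassmann manifold: the charts `p_{E,F} = q_{E,F}⁻¹`, from the set of
complements of `F` to `𝓛(E, F)`, for all pairs `(E, F)` of complementary subspaces. -/
def grassmannAtlas : Set (BanachChart 𝕜 (BanachGrassmannian 𝕜 X)) :=
  Set.range fun p : ComplementaryPair 𝕜 X =>
    ⟨p.fst.toSubmodule →L[𝕜] p.snd.toSubmodule, (p.bijOn_graphMap.toPartialEquiv p.graphMap univ _).symm⟩

end Grassmannian

/-! ### Idempotents -/

/-- The set `ℐ(X)` of idempotents in `𝓛(X)` other than `0` and `I`, with the norm topology. -/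
abbrev Idempotents (𝕜 : Type*) [RCLike 𝕜] (X : Type*) [NormedAddCommGroup X]
    [NormedSpace 𝕜 X] : Type _ :=
  {Q : X →L[𝕜] X // IsIdempotentElem Q ∧ Q ≠ 0 ∧ Q ≠ 1}

/-- The idempotent `Q_E^F` with range `E` and kernel `F`. -/
def ComplementaryPair.idempotent {𝕜 : Type*} [RCLike 𝕜] {X : Type*} [NormedAddCommGroup X]
    [NormedSpace 𝕜 X] [CompleteSpace X] (p : ComplementaryPair 𝕜 X) : Idempotents 𝕜 X :=
  ⟨p.fst.toSubmodule.projectionL p.snd.toSubmodule (isTopCompl p.isCompl), Submodule.isIdempotentElem_projectionL _, by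
    intro h
    apply p.fst.ne_bot
    rw [← Submodule.range_projectionL (isTopCompl p.isCompl)]
    change LinearMap.range ((p.fst.toSubmodule.projectionL p.snd.toSubmodule (isTopCompl p.isCompl)) : X →ₗ[𝕜] X) = ⊥
    rw [h]
    simp, by
    intro h
    apply p.snd.ne_bot
    rw [← Submodule.ker_projectionL (isTopCompl p.isCompl)]
    change LinearMap.ker ((p.fst.toSubmodule.projectionL p.snd.toSubmodule (isTopCompl p.isCompl)) : X →ₗ[𝕜] X) = ⊥
    rw [h]
    exact LinearMap.ker_id⟩

theorem ComplementaryPair.range_ker_idempotent {𝕜 : Type*} [RCLike 𝕜] {X : Type*}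
    [NormedAddCommGroup X] [NormedSpace 𝕜 X] [CompleteSpace X] (p : ComplementaryPair 𝕜 X) :
    LinearMap.range (p.idempotent.1 : X →ₗ[𝕜] X) = p.fst.toSubmodule ∧
      LinearMap.ker (p.idempotent.1 : X →ₗ[𝕜] X) = p.snd.toSubmodule :=
  ⟨Submodule.range_projectionL _, Submodule.ker_projectionL _⟩

end

/-! Range and kernel recover the pair from the idempotent, so `(E, F) ↦ Q_E^F` is a bijection by
algebra. The rest comes from one explicit parametrization around a fixed pair `p = (E₀, F₀)` with
idempotent `Q₀`.

Every complement of `F₀` is the graph of a unique `T : E₀ → F₀`. The shear `g_T = I + T Q₀` is an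
automorphism of `X` with inverse `g_{-T}`; it carries `E₀` onto that graph, so conjugation by it
carries the idempotents onto `E₀` affinely onto the idempotents onto the graph (`shearConj_mem`,
`shearConj_neg_mem`). The idempotents onto `E₀` are exactly the operators `Q₀ + S (I - Q₀)` with `S
: F₀ → E₀` (`idempotent_add_extend_mem`, `idempotent_add_extend_block`). Hence `(T, S) ↦ g_T (Q₀ + S
(I - Q₀)) g_{-T}` parametrizes all pairs whose first member is a complement of `F₀`. It is
polynomial in `(T, S)`. These maps give the charts of `𝒫`, and with `S` replaced by the idempotent
onto `E₀` that it describes they give the local trivializations. Coordinate changes and bundle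
transitions are analytic because those of the Grassmannian are (`contDiffAt_coordChange`), and the
latter involve only composition and inversion of operators.

The homeomorphism is local in both directions. If `(E, F)` is near `p`, the operator which is `I +
T` on `E₀` and `I + S` on `F₀`, with `E` and `F` the graphs of `T` and `S`, is invertible and
conjugates `Q₀` to `Q_E^F` (`continuous_idempotent`). If an idempotent `A` is near `Q₀`, its range
is the graph of `W V⁻¹`, where `V` and `W` are the components of `A` restricted to `E₀`
(`Idempotents.continuous_toPair_fst`); kernels are ranges of `I - A`.

For the immersion, the off-diagonal blocks of the parametrized idempotent are `(T - T S T, S)`,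
whose derivative at the origin is the identity. So taking blocks is a bounded left inverse of the
derivative (`offDiag_comp_fderiv`). -/

noncomputable section

/-! ### General facts on analytic Banach manifolds -/

section Manifold

variable {𝕜 : Type*} [RCLike 𝕜] {M N : Type*} [TopologicalSpace M] [TopologicalSpace N]

namespace IsBanachManifold

/-- Coordinate changes are analytic at every point of the overlap of two chart domains. -/
theorem analyticAt_coordChange {A : Set (BanachChart 𝕜 M)} (hA : IsBanachManifold A)
    {c d : BanachChart 𝕜 M} (hc : c ∈ A) (hd : d ∈ A) {x : M}
    (hxc : x ∈ c.toPartialEquiv.source) (hxd : x ∈ d.toPartialEquiv.source) :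
    AnalyticAt 𝕜 (fun z => d.toPartialEquiv (c.toPartialEquiv.symm z)) (c.toPartialEquiv x) := by
  refine hA.analytic c hc d hd _ ?_
  simp only [PartialEquiv.trans_source, PartialEquiv.symm_source, mem_inter_iff, mem_preimage]
  exact ⟨c.toPartialEquiv.map_source hxc, by rwa [c.toPartialEquiv.left_inv hxc]⟩

theorem continuousAt {A : Set (BanachChart 𝕜 M)} (hA : IsBanachManifold A)
    {c : BanachChart 𝕜 M} (hc : c ∈ A) {x : M} (hx : x ∈ c.toPartialEquiv.source) :
    ContinuousAt c.toPartialEquiv x :=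
  (hA.continuousOn c hc).continuousAt ((hA.isOpen_source c hc).mem_nhds hx)

theorem continuousAt_symm {A : Set (BanachChart 𝕜 M)} (hA : IsBanachManifold A)
    {c : BanachChart 𝕜 M} (hc : c ∈ A) {z : c.Model} (hz : z ∈ c.toPartialEquiv.target) :
    ContinuousAt c.toPartialEquiv.symm z :=
  (hA.continuousOn_symm c hc).continuousAt ((hA.isOpen_target c hc).mem_nhds hz)

end IsBanachManifold

/-- Analyticity of a map between manifolds may be checked in one pair of charts around each
point. -/
theorem IsAnalyticOn.of_exists_charts {A : Set (BanachChart 𝕜 M)} {B : Set (BanachChart 𝕜 N)}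
    (hA : IsBanachManifold A) (hB : IsBanachManifold B) {f : M → N} {s : Set M}
    (h : ∀ x ∈ s, ∃ c ∈ A, ∃ d ∈ B, x ∈ c.toPartialEquiv.source ∧
      (∀ᶠ y in 𝓝 x, f y ∈ d.toPartialEquiv.source) ∧
      AnalyticAt 𝕜 (fun z => d.toPartialEquiv (f (c.toPartialEquiv.symm z)))
        (c.toPartialEquiv x)) :
    IsAnalyticOn A B f s := by
  have hcont : ∀ x ∈ s, ContinuousAt f x := by
    intro x hx
    obtain ⟨c, hc, d, hd, hxc, hfd, han⟩ := h x hx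
    -- Continuity is not assumed: near `x` the map `f` equals `d⁻¹ ∘ (d ∘ f ∘ c⁻¹) ∘ c`, whose
    -- middle factor is analytic, hence continuous.
    have h1 : ContinuousAt (fun y => d.toPartialEquiv.symm
        (d.toPartialEquiv (f (c.toPartialEquiv.symm (c.toPartialEquiv y))))) x := by
      have hd' : d.toPartialEquiv (f (c.toPartialEquiv.symm (c.toPartialEquiv x))) ∈
          d.toPartialEquiv.target := by
        rw [c.toPartialEquiv.left_inv hxc]
        exact d.toPartialEquiv.map_source hfd.self_of_nhds
      exact ContinuousAt.comp (g := d.toPartialEquiv.symm) (hB.continuousAt_symm hd hd')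
        (ContinuousAt.comp (f := c.toPartialEquiv) han.continuousAt (hA.continuousAt hc hxc))
    have h2 := h1.congr (f := _) (g := f) (by
      filter_upwards [hfd, (hA.isOpen_source c hc).mem_nhds hxc] with y hy hyc
      rw [c.toPartialEquiv.left_inv hyc, d.toPartialEquiv.left_inv hy])
    exact h2
  refine ⟨fun x hx => (hcont x hx).continuousWithinAt, ?_⟩
  intro x hx c' hc' d' hd' hxc' hfd'
  obtain ⟨c, hc, d, hd, hxc, hfd, han⟩ := h x hx
  have hfx := hfd.self_of_nhds
  -- Near the base point `d' ∘ f ∘ c'⁻¹` is `(d' ∘ d⁻¹) ∘ (d ∘ f ∘ c⁻¹) ∘ (c ∘ c'⁻¹)`; the outer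
  -- factors are coordinate changes.
  have h1 := hA.analyticAt_coordChange hc' hc hxc' hxc
  have h2 := hB.analyticAt_coordChange hd hd' hfx hfd'
  have e1 : c.toPartialEquiv (c'.toPartialEquiv.symm (c'.toPartialEquiv x)) =
      c.toPartialEquiv x := by rw [c'.toPartialEquiv.left_inv hxc']
  have h3 := AnalyticAt.fun_comp (f := fun z => c.toPartialEquiv (c'.toPartialEquiv.symm z))
    (x := c'.toPartialEquiv x) (by rw [e1]; exact han) h1
  have e2 : d.toPartialEquiv (f (c.toPartialEquiv.symm
      (c.toPartialEquiv (c'.toPartialEquiv.symm (c'.toPartialEquiv x))))) =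
      d.toPartialEquiv (f x) := by rw [e1, c.toPartialEquiv.left_inv hxc]
  have h4 := AnalyticAt.fun_comp (x := c'.toPartialEquiv x) (by rw [e2]; exact h2) h3
  refine h4.congr ?_
  have hx' : c'.toPartialEquiv.symm (c'.toPartialEquiv x) = x := c'.toPartialEquiv.left_inv hxc'
  have hs := hA.continuousAt_symm hc' (c'.toPartialEquiv.map_source hxc')
  have hev : ∀ᶠ y in 𝓝 x, y ∈ c.toPartialEquiv.source ∧ f y ∈ d.toPartialEquiv.source :=
    Filter.Eventually.and ((hA.isOpen_source c hc).mem_nhds hxc) hfd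
  rw [ContinuousAt, hx'] at hs
  filter_upwards [hs.eventually hev] with z hz
  rw [c.toPartialEquiv.left_inv hz.1, d.toPartialEquiv.left_inv hz.2]

theorem isBanachManifold_vectorAtlas (Z : Type*) [NormedAddCommGroup Z] [NormedSpace 𝕜 Z]
    [hZ : CompleteSpace Z] : IsBanachManifold (vectorAtlas 𝕜 Z) where
  t2 := inferInstance
  complete := by rintro _ rfl; exact hZ
  cover x := ⟨_, rfl, mem_univ x⟩
  isOpen_source := by rintro _ rfl; exact isOpen_univ
  isOpen_target := by rintro _ rfl; exact isOpen_univ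
  continuousOn := by rintro _ rfl; exact continuousOn_id
  continuousOn_symm := by rintro _ rfl; exact continuousOn_id
  analytic := by rintro _ rfl _ rfl z _; exact analyticAt_id

theorem IsBanachManifold.prod {A : Set (BanachChart 𝕜 M)} {B : Set (BanachChart 𝕜 N)}
    (hA : IsBanachManifold A) (hB : IsBanachManifold B) : IsBanachManifold (prodAtlas A B) where
  t2 := by
    have := hA.t2
    have := hB.t2
    infer_instance
  complete := by
    rintro _ ⟨c, hc, d, hd, rfl⟩
    have := hA.complete c hc
    have := hB.complete d hd
    exact (inferInstance : CompleteSpace (c.Model × d.Model))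
  cover := by
    rintro ⟨x, y⟩
    obtain ⟨c, hc, hx⟩ := hA.cover x
    obtain ⟨d, hd, hy⟩ := hB.cover y
    exact ⟨_, ⟨c, hc, d, hd, rfl⟩, ⟨hx, hy⟩⟩
  isOpen_source := by
    rintro _ ⟨c, hc, d, hd, rfl⟩
    exact (hA.isOpen_source c hc).prod (hB.isOpen_source d hd)
  isOpen_target := by
    rintro _ ⟨c, hc, d, hd, rfl⟩
    exact (hA.isOpen_target c hc).prod (hB.isOpen_target d hd)
  continuousOn := by
    rintro _ ⟨c, hc, d, hd, rfl⟩
    exact (hA.continuousOn c hc).prodMap (hB.continuousOn d hd)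
  continuousOn_symm := by
    rintro _ ⟨c, hc, d, hd, rfl⟩
    exact (hA.continuousOn_symm c hc).prodMap (hB.continuousOn_symm d hd)
  analytic := by
    rintro _ ⟨c, hc, d, hd, rfl⟩ _ ⟨c', hc', d', hd', rfl⟩ ⟨z, w⟩ hzw
    have h1 : z ∈ (c.toPartialEquiv.symm.trans c'.toPartialEquiv).source := ⟨hzw.1.1, hzw.2.1⟩
    have h2 : w ∈ (d.toPartialEquiv.symm.trans d'.toPartialEquiv).source := ⟨hzw.1.2, hzw.2.2⟩
    have h3 := (hA.analytic c hc c' hc' z h1).fun_comp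
      (f := fun zw : c.Model × d.Model => zw.1) (x := (z, w)) analyticAt_fst
    have h4 := (hB.analytic d hd d' hd' w h2).fun_comp
      (f := fun zw : c.Model × d.Model => zw.2) (x := (z, w)) analyticAt_snd
    exact h3.prod h4

theorem AffineBanachSubspace.isClosed_direction {Y : Type*} [NormedAddCommGroup Y]
    [NormedSpace 𝕜 Y] (S : AffineBanachSubspace 𝕜 Y) : IsClosed (S.space.direction : Set Y) :=
  (AffineSubspace.isClosed_direction_iff S.space).2 S.isClosed

theorem isBanachManifold_affineAtlas {Y : Type*} [NormedAddCommGroup Y] [NormedSpace 𝕜 Y]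
    [CompleteSpace Y] (S : AffineBanachSubspace 𝕜 Y) : IsBanachManifold (affineAtlas S) where
  t2 := inferInstance
  complete := by rintro _ ⟨a, rfl⟩; exact S.isClosed_direction.completeSpace_coe
  cover x := ⟨_, ⟨x, rfl⟩, mem_univ _⟩
  isOpen_source := by rintro _ ⟨a, rfl⟩; exact isOpen_univ
  isOpen_target := by rintro _ ⟨a, rfl⟩; exact isOpen_univ
  continuousOn := by
    rintro _ ⟨a, rfl⟩
    exact Continuous.continuousOn
      (continuous_induced_rng.2 (continuous_subtype_val.sub continuous_const))
  continuousOn_symm := by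
    rintro _ ⟨a, rfl⟩
    exact Continuous.continuousOn
      (continuous_induced_rng.2 (continuous_subtype_val.add continuous_const))
  analytic := by
    rintro _ ⟨a, rfl⟩ _ ⟨b, rfl⟩ z _
    have h : AnalyticAt 𝕜 (fun z : S.space.direction => z + (a -ᵥ b)) z :=
      analyticAt_id.add analyticAt_const
    refine h.congr (Filter.Eventually.of_forall fun y => ?_)
    exact (vadd_vsub_assoc y a b).symm

end Manifold

/-! ### The Grassmann manifold -/

/-- Disjointness from the kernel is injectivity of `q ∘ j`, and spanning together with the kernel is
its surjectivity. This turns complementarity into invertibility of an operator, which is an open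
condition. -/
theorem LinearMap.isCompl_range_ker_iff_bijective_comp {R E G H : Type*} [Ring R]
    [AddCommGroup E] [AddCommGroup G] [AddCommGroup H] [Module R E] [Module R G] [Module R H]
    {j : E →ₗ[R] G} {q : G →ₗ[R] H} (hj : Function.Injective j) (hq : Function.Surjective q) :
    IsCompl (LinearMap.range j) (LinearMap.ker q) ↔ Function.Bijective (q ∘ₗ j) := by
  constructor
  · intro h
    refine ⟨(injective_iff_map_eq_zero _).2 fun e he => ?_, fun y => ?_⟩
    · apply hj
      rw [map_zero]
      exact Submodule.disjoint_def.1 h.disjoint _ ⟨e, rfl⟩ he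
    · obtain ⟨x, rfl⟩ := hq y
      have hx : x ∈ LinearMap.range j ⊔ LinearMap.ker q := by rw [h.sup_eq_top]; trivial
      obtain ⟨_, ⟨e, rfl⟩, k, hk, rfl⟩ := Submodule.mem_sup.1 hx
      exact ⟨e, by simp [LinearMap.mem_ker.1 hk]⟩
  · intro h
    constructor
    · rw [Submodule.disjoint_def]
      rintro _ ⟨e, rfl⟩ he
      have : e = 0 := h.1 (by simpa using he)
      simp [this]
    · rw [codisjoint_iff, Submodule.eq_top_iff']
      intro x
      obtain ⟨e, he⟩ := h.2 (q x)
      refine Submodule.mem_sup.2 ⟨j e, ⟨e, rfl⟩, x - j e, ?_, by abel⟩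
      simpa [sub_eq_zero] using he.symm

section Grassmannian

variable {𝕜 : Type*} [RCLike 𝕜] {X : Type*} [NormedAddCommGroup X] [NormedSpace 𝕜 X]

instance BanachGrassmannian.completeSpace [CompleteSpace X] (E : BanachGrassmannian 𝕜 X) :
    CompleteSpace E.toSubmodule :=
  E.closedComplemented.isClosed.completeSpace_coe

/-- A pair of complementary subspaces with first member `E`. -/
def BanachGrassmannian.pair [CompleteSpace X] (E : BanachGrassmannian 𝕜 X) :
    ComplementaryPair 𝕜 X where
  fst := E
  snd := ⟨E.closedComplemented.complement,
    E.closedComplemented.isTopCompl_complement.symm.closedComplemented,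
    fun h => E.ne_top (by simpa [h] using E.closedComplemented.isCompl_complement.sup_eq_top),
    fun h => E.ne_bot (by simpa [h] using E.closedComplemented.isCompl_complement.inf_eq_bot)⟩
  isCompl := E.closedComplemented.isCompl_complement

/-- Every point of the Grassmannian has a complement in it. -/
theorem BanachGrassmannian.exists_pair [CompleteSpace X] (E : BanachGrassmannian 𝕜 X) :
    ∃ p : ComplementaryPair 𝕜 X, p.fst = E := ⟨E.pair, rfl⟩

/-! ### Graph charts of the Grassmannian and their coordinate changes -/

namespace ComplementaryPair

/-- The pair `(F, E)`, for `p = (E, F)`. -/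
def swap (p : ComplementaryPair 𝕜 X) : ComplementaryPair 𝕜 X := ⟨p.snd, p.fst, p.isCompl.symm⟩

/-- The map `e ↦ e + T e`, a parametrization of the graph of `T`. -/
def graphEmb (p : ComplementaryPair 𝕜 X) (T : p.fst.toSubmodule →L[𝕜] p.snd.toSubmodule) : p.fst.toSubmodule →L[𝕜] X :=
  p.fst.toSubmodule.subtypeL + p.snd.toSubmodule.subtypeL ∘L T

@[simp] theorem graphEmb_apply {p : ComplementaryPair 𝕜 X}
    (T : p.fst.toSubmodule →L[𝕜] p.snd.toSubmodule) (e : p.fst.toSubmodule) : p.graphEmb T e = (e : X) + T e := rfl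

@[fun_prop]
theorem contDiff_graphEmb (p : ComplementaryPair 𝕜 X) {n : WithTop ℕ∞} : ContDiff 𝕜 n p.graphEmb :=
  contDiff_const.add (contDiff_const.clm_comp contDiff_id)

variable [CompleteSpace X]

/-- The projection onto `E` along `F`, for `p = (E, F)`. -/
def fstProj (p : ComplementaryPair 𝕜 X) : X →L[𝕜] p.fst.toSubmodule :=
  p.fst.toSubmodule.projectionOntoL p.snd.toSubmodule (isTopCompl p.isCompl)

/-- The projection onto `F` along `E`, for `p = (E, F)`. -/
def sndProj (p : ComplementaryPair 𝕜 X) : X →L[𝕜] p.snd.toSubmodule :=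
  p.snd.toSubmodule.projectionOntoL p.fst.toSubmodule (isTopCompl p.isCompl.symm)

variable (p q : ComplementaryPair 𝕜 X)

@[simp] theorem fstProj_fst (e : p.fst.toSubmodule) : p.fstProj e = e :=
  Submodule.projectionOntoL_apply_left _ e

@[simp] theorem fstProj_snd (f : p.snd.toSubmodule) : p.fstProj f = 0 :=
  Submodule.projectionOntoL_apply_right _ f

@[simp] theorem sndProj_snd (f : p.snd.toSubmodule) : p.sndProj f = f :=
  Submodule.projectionOntoL_apply_left _ f

@[simp] theorem sndProj_fst (e : p.fst.toSubmodule) : p.sndProj e = 0 :=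
  Submodule.projectionOntoL_apply_right _ e

theorem fstProj_add_sndProj (x : X) : (p.fstProj x : X) + p.sndProj x = x :=
  Submodule.projectionL_add_projectionL_eq_self (isTopCompl p.isCompl) x

theorem fstProj_eq_zero_iff {x : X} : p.fstProj x = 0 ↔ x ∈ p.snd.toSubmodule :=
  Submodule.projectionOntoL_apply_eq_zero_iff _

theorem sndProj_eq_zero_iff {x : X} : p.sndProj x = 0 ↔ x ∈ p.fst.toSubmodule :=
  Submodule.projectionOntoL_apply_eq_zero_iff _

theorem fstProj_surjective : Function.Surjective p.fstProj := fun e => ⟨e, p.fstProj_fst e⟩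

variable {p q}

theorem graphEmb_injective (T : p.fst.toSubmodule →L[𝕜] p.snd.toSubmodule) :
    Function.Injective (p.graphEmb T) := fun e e' h => by
  simpa using congrArg p.fstProj h

theorem isCompl_graph_iff {T : p.fst.toSubmodule →L[𝕜] p.snd.toSubmodule} :
    IsCompl (p.graphMap T).toSubmodule q.snd.toSubmodule ↔
      Function.Bijective (q.fstProj ∘L p.graphEmb T) := by
  have h := LinearMap.isCompl_range_ker_iff_bijective_comp
    (j := (p.graphEmb T : p.fst.toSubmodule →ₗ[𝕜] X)) (q := (q.fstProj : X →ₗ[𝕜] q.fst.toSubmodule))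
    (graphEmb_injective T) q.fstProj_surjective
  have hk : LinearMap.ker (q.fstProj : X →ₗ[𝕜] q.fst.toSubmodule) = q.snd.toSubmodule :=
    Submodule.ext fun x => q.fstProj_eq_zero_iff
  rw [hk] at h
  exact h

/-- By the open mapping theorem a bijective bounded operator between Banach spaces has a bounded
inverse. -/
theorem isCompl_graph_iff_exists_equiv {T : p.fst.toSubmodule →L[𝕜] p.snd.toSubmodule} :
    IsCompl (p.graphMap T).toSubmodule q.snd.toSubmodule ↔
      ∃ e : p.fst.toSubmodule ≃L[𝕜] q.fst.toSubmodule,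
        (e : p.fst.toSubmodule →L[𝕜] q.fst.toSubmodule) = q.fstProj ∘L p.graphEmb T := by
  rw [isCompl_graph_iff]
  constructor
  · intro h
    exact ⟨ContinuousLinearEquiv.ofBijective _ (LinearMap.ker_eq_bot.2 h.1)
      (LinearMap.range_eq_top.2 h.2), ContinuousLinearEquiv.coe_ofBijective _ _ _⟩
  · rintro ⟨e, he⟩
    rw [← he]
    exact e.bijective

variable (p q) in
/-- The subspaces which are graphs for `p` and complements of the second member of `q`, in the
coordinate of `p`, form an open set. -/
theorem isOpen_setOf_isCompl_graph :
    IsOpen {T | IsCompl (p.graphMap T).toSubmodule q.snd.toSubmodule} := by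
  have h : Continuous fun T => q.fstProj ∘L p.graphEmb T :=
    (contDiff_const.clm_comp p.contDiff_graphEmb : ContDiff 𝕜 0 _).continuous
  have h2 := (ContinuousLinearEquiv.isOpen (𝕜 := 𝕜) (E := p.fst.toSubmodule)
    (F := q.fst.toSubmodule)).preimage h
  convert h2 using 1
  ext T
  exact isCompl_graph_iff_exists_equiv

/-- The coordinate change from the chart of `p` to the chart of `q`. -/
def coordChange (p q : ComplementaryPair 𝕜 X) (T : p.fst.toSubmodule →L[𝕜] p.snd.toSubmodule) :
    q.fst.toSubmodule →L[𝕜] q.snd.toSubmodule :=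
  (q.sndProj ∘L p.graphEmb T) ∘L (q.fstProj ∘L p.graphEmb T).inverse

/-- The vector `x + T x` has `q`-components `e x` and `coordChange p q T (e x)`, so both graphs
consist of the same vectors, reparametrized by `e`. -/
theorem graphMap_coordChange {T : p.fst.toSubmodule →L[𝕜] p.snd.toSubmodule}
    (h : IsCompl (p.graphMap T).toSubmodule q.snd.toSubmodule) :
    q.graphMap (coordChange p q T) = p.graphMap T := by
  obtain ⟨e, he⟩ := isCompl_graph_iff_exists_equiv.1 h
  have key : ∀ x, (e x : X) + coordChange p q T (e x) = x + T x := by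
    intro x
    have h1 : (e x : q.fst.toSubmodule) = q.fstProj (p.graphEmb T x) := DFunLike.congr_fun he x
    have h2 : coordChange p q T (e x) = q.sndProj (p.graphEmb T x) := by
      simp only [coordChange, ← he, ContinuousLinearMap.inverse_equiv]
      simp
    rw [h2, h1, q.fstProj_add_sndProj, graphEmb_apply]
  refine BanachGrassmannian.ext (Submodule.ext fun x => ?_)
  change x ∈ q.graph _ ↔ x ∈ p.graph _
  rw [mem_graph, mem_graph]
  constructor
  · rintro ⟨y, rfl⟩
    obtain ⟨y, rfl⟩ := e.surjective y
    exact ⟨y, (key y).symm⟩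
  · rintro ⟨y, rfl⟩
    exact ⟨e y, key y⟩

/-- Inversion of operators is analytic at an invertible operator. The order `n` is kept free: order
`0` yields continuity, and the top order `⊤` of `WithTop ℕ∞` yields analyticity. -/
theorem contDiffAt_coordChange {n : WithTop ℕ∞} {T : p.fst.toSubmodule →L[𝕜] p.snd.toSubmodule}
    (h : IsCompl (p.graphMap T).toSubmodule q.snd.toSubmodule) :
    ContDiffAt 𝕜 n (coordChange p q) T := by
  obtain ⟨e, he⟩ := isCompl_graph_iff_exists_equiv.1 h
  have h1 : ContDiffAt 𝕜 n (fun T => q.fstProj ∘L p.graphEmb T) T :=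
    (contDiff_const.clm_comp p.contDiff_graphEmb).contDiffAt
  have h2 : ContDiffAt 𝕜 n (fun T => q.sndProj ∘L p.graphEmb T) T :=
    (contDiff_const.clm_comp p.contDiff_graphEmb).contDiffAt
  have h3 := contDiffAt_map_inverse (n := n) e
  rw [he] at h3
  exact h2.clm_comp (ContDiffAt.comp (g := ContinuousLinearMap.inverse) T h3 h1)

/-- The coordinate of `E` in the chart of `p`. -/
def coord (p : ComplementaryPair 𝕜 X) (E : BanachGrassmannian 𝕜 X) :
    p.fst.toSubmodule →L[𝕜] p.snd.toSubmodule :=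
  Function.invFunOn p.graphMap univ E

@[simp] theorem coord_graphMap (T : p.fst.toSubmodule →L[𝕜] p.snd.toSubmodule) :
    p.coord (p.graphMap T) = T :=
  p.bijOn_graphMap.invOn_invFunOn.1 (mem_univ T)

theorem graphMap_coord {E : BanachGrassmannian 𝕜 X}
    (h : IsCompl E.toSubmodule p.snd.toSubmodule) : p.graphMap (p.coord E) = E :=
  p.bijOn_graphMap.invOn_invFunOn.2 h

theorem coord_graphMap_eq_coordChange {T : p.fst.toSubmodule →L[𝕜] p.snd.toSubmodule}
    (h : IsCompl (p.graphMap T).toSubmodule q.snd.toSubmodule) :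
    q.coord (p.graphMap T) = coordChange p q T := by
  rw [← graphMap_coordChange h, coord_graphMap]

theorem contDiffAt_coord_graphMap {n : WithTop ℕ∞}
    {T : p.fst.toSubmodule →L[𝕜] p.snd.toSubmodule}
    (h : IsCompl (p.graphMap T).toSubmodule q.snd.toSubmodule) :
    ContDiffAt 𝕜 n (fun T => q.coord (p.graphMap T)) T :=
  (contDiffAt_coordChange h).congr_of_eventuallyEq
    (by filter_upwards [(isOpen_setOf_isCompl_graph p q).mem_nhds h] with S hS
        exact coord_graphMap_eq_coordChange hS)

variable (p) in
@[simp] theorem graphMap_zero : p.graphMap 0 = p.fst := by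
  refine BanachGrassmannian.ext (Submodule.ext fun x => ?_)
  change x ∈ p.graph _ ↔ _
  simp [mem_graph]

variable (p) in
@[simp] theorem coord_fst : p.coord p.fst = 0 := by
  conv_lhs => rw [← p.graphMap_zero]
  exact coord_graphMap 0

variable (p) in
theorem continuous_graphMap : Continuous p.graphMap :=
  continuous_iff_coinduced_le.2 (le_iSup
    (fun p : ComplementaryPair 𝕜 X => TopologicalSpace.coinduced p.graphMap inferInstance) p)

theorem isOpen_grassmannian_iff {s : Set (BanachGrassmannian 𝕜 X)} :
    IsOpen s ↔ ∀ p : ComplementaryPair 𝕜 X, IsOpen (p.graphMap ⁻¹' s) := by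
  refine isOpen_iSup_iff.trans (forall_congr' fun p => isOpen_coinduced)

variable (p) in
theorem isOpen_setOf_isCompl_snd :
    IsOpen {E : BanachGrassmannian 𝕜 X | IsCompl E.toSubmodule p.snd.toSubmodule} :=
  isOpen_grassmannian_iff.2 fun q => isOpen_setOf_isCompl_graph q p

-- In the final topology a set is open when all its preimages under the graph maps are, so the
-- continuity of `coord` reduces to that of the coordinate changes.
variable (p) in
theorem continuousOn_coord :
    ContinuousOn p.coord {E | IsCompl E.toSubmodule p.snd.toSubmodule} := by
  rw [continuousOn_open_iff (isOpen_setOf_isCompl_snd p)]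
  intro O hO
  refine isOpen_grassmannian_iff.2 fun q => ?_
  have h : ContinuousOn (fun T => p.coord (q.graphMap T))
      {T | IsCompl (q.graphMap T).toSubmodule p.snd.toSubmodule} := fun T hT =>
    (contDiffAt_coord_graphMap (n := 0) hT).continuousAt.continuousWithinAt
  exact h.isOpen_inter_preimage (isOpen_setOf_isCompl_graph q p) hO

theorem continuousAt_coord {E : BanachGrassmannian 𝕜 X}
    (h : IsCompl E.toSubmodule p.snd.toSubmodule) : ContinuousAt p.coord E :=
  (continuousOn_coord p).continuousAt ((isOpen_setOf_isCompl_snd p).mem_nhds h)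

variable (p) in
theorem isOpenMap_graphMap : IsOpenMap p.graphMap := by
  intro O hO
  convert (continuousOn_coord p).isOpen_inter_preimage (isOpen_setOf_isCompl_snd p) hO using 1
  ext E
  constructor
  · rintro ⟨T, hT, rfl⟩
    exact ⟨p.isCompl_graph T, by simpa using hT⟩
  · rintro ⟨hE, hT⟩
    exact ⟨_, hT, graphMap_coord hE⟩

end ComplementaryPair

open ComplementaryPair

variable [CompleteSpace X]

instance : T2Space (BanachGrassmannian 𝕜 X) := by
  refine t2Space_iff_disjoint_nhds.2 fun E E' hne => ?_
  -- Of two distinct subspaces, one is not contained in the other.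
  wlog hle : ¬ E.toSubmodule ≤ E'.toSubmodule generalizing E E'
  · refine (this E' E hne.symm fun h => hne ?_).symm
    exact BanachGrassmannian.ext (le_antisymm (not_not.1 hle) h)
  obtain ⟨x, hx, hx'⟩ := SetLike.not_le_iff_exists.1 hle
  obtain ⟨p, rfl⟩ := E.exists_pair
  obtain ⟨p', rfl⟩ := E'.exists_pair
  -- A pair of coordinates lies in `W` when the perturbed vector `x + T.1 x` is not in the graph of
  -- `T.2`; then the two graphs differ. This is an open condition, and it holds at `(0, 0)` because
  -- `x` is not in `E'`.
  let W : Set ((p.fst.toSubmodule →L[𝕜] p.snd.toSubmodule) ×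
      (p'.fst.toSubmodule →L[𝕜] p'.snd.toSubmodule)) :=
    {T | p'.sndProj (x + T.1 ⟨x, hx⟩) ≠ T.2 (p'.fstProj (x + T.1 ⟨x, hx⟩))}
  have hW : IsOpen W := by
    refine isOpen_ne_fun ?_ ?_
    · fun_prop
    · fun_prop
  have h0 : ((0, 0) : _ × _) ∈ W := by
    simpa [W, p'.sndProj_eq_zero_iff] using hx'
  obtain ⟨N, N', hN, h0N, hN', h0N', hsub⟩ := mem_nhds_prod_iff'.1 (hW.mem_nhds h0)
  rw [Filter.disjoint_iff]
  refine ⟨_, (p.isOpenMap_graphMap N hN).mem_nhds ⟨0, h0N, p.graphMap_zero⟩,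
    _, (p'.isOpenMap_graphMap N' hN').mem_nhds ⟨0, h0N', p'.graphMap_zero⟩, ?_⟩
  rw [Set.disjoint_left]
  rintro _ ⟨T, hT, rfl⟩ ⟨T', hT', h⟩
  have hmem : x + T ⟨x, hx⟩ ∈ p'.graph T' := by
    have : x + T ⟨x, hx⟩ ∈ p.graph T := (mem_graph _ _ _).2 ⟨⟨x, hx⟩, rfl⟩
    have h' : p'.graph T' = p.graph T := congrArg BanachGrassmannian.toSubmodule h
    rwa [h']
  obtain ⟨e, he⟩ := (mem_graph _ _ _).1 hmem
  have h1 : ((T, T') : _ × _) ∈ W := hsub ⟨hT, hT'⟩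
  apply h1
  simp [← he]

/-- The Grassmannian is an analytic Banach manifold. -/
theorem isBanachManifold_grassmannAtlas : IsBanachManifold (grassmannAtlas 𝕜 X) where
  t2 := inferInstance
  complete := by
    rintro _ ⟨p, rfl⟩
    exact (inferInstance : CompleteSpace (p.fst.toSubmodule →L[𝕜] p.snd.toSubmodule))
  cover E := by
    obtain ⟨p, rfl⟩ := E.exists_pair
    exact ⟨_, ⟨p, rfl⟩, p.isCompl⟩
  isOpen_source := by rintro _ ⟨p, rfl⟩; exact p.isOpen_setOf_isCompl_snd
  isOpen_target := by rintro _ ⟨p, rfl⟩; exact isOpen_univ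
  continuousOn := by rintro _ ⟨p, rfl⟩; exact p.continuousOn_coord
  continuousOn_symm := by rintro _ ⟨p, rfl⟩; exact p.continuous_graphMap.continuousOn
  analytic := by
    rintro _ ⟨p, rfl⟩ _ ⟨q, rfl⟩ T hT
    exact (contDiffAt_coord_graphMap (q := q) hT.2).analyticAt

end Grassmannian

/-! ### Pairs of complementary subspaces and idempotents -/

section Pairs

variable {𝕜 : Type*} [RCLike 𝕜] {X : Type*} [NormedAddCommGroup X] [NormedSpace 𝕜 X]

/-- The idempotents with range `E`, as an affine subspace of `𝓛(X)`. -/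
def BanachGrassmannian.idempotentsOnto (E : BanachGrassmannian 𝕜 X) :
    AffineSubspace 𝕜 (X →L[𝕜] X) where
  carrier := {A | (∀ x, A x ∈ E.toSubmodule) ∧ ∀ e ∈ E.toSubmodule, A e = e}
  smul_vsub_vadd_mem' := by
    intro c A B C hA hB hC
    refine ⟨fun x => ?_, fun e he => ?_⟩
    · exact E.toSubmodule.add_mem (E.toSubmodule.smul_mem c
        (E.toSubmodule.sub_mem (hA.1 x) (hB.1 x))) (hC.1 x)
    · simp [hA.2 e he, hB.2 e he, hC.2 e he]

theorem BanachGrassmannian.mem_idempotentsOnto {E : BanachGrassmannian 𝕜 X} {A : X →L[𝕜] X} :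
    A ∈ E.idempotentsOnto ↔ (∀ x, A x ∈ E.toSubmodule) ∧ ∀ e ∈ E.toSubmodule, A e = e := Iff.rfl

/-- An operator with values in `E` that fixes `E` pointwise is idempotent; `0` and `I` are excluded
since `E` is neither zero nor all of `X`. -/
theorem BanachGrassmannian.isIdempotentElem_of_mem {E : BanachGrassmannian 𝕜 X} {A : X →L[𝕜] X}
    (hA : A ∈ E.idempotentsOnto) : IsIdempotentElem A ∧ A ≠ 0 ∧ A ≠ 1 := by
  refine ⟨ContinuousLinearMap.ext fun x => hA.2 _ (hA.1 x), ?_, ?_⟩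
  · rintro rfl
    exact E.ne_bot ((Submodule.eq_bot_iff _).2 fun e he => (hA.2 e he).symm)
  · rintro rfl
    exact E.ne_top (Submodule.eq_top_iff'.2 fun x => hA.1 x)

theorem Idempotents.apply_apply (A : Idempotents 𝕜 X) (x : X) : A.1 (A.1 x) = A.1 x :=
  DFunLike.congr_fun A.2.1 x

/-- The pair formed by the range and the kernel of an idempotent. -/
def Idempotents.toPair (A : Idempotents 𝕜 X) : ComplementaryPair 𝕜 X where
  fst := ⟨LinearMap.range (A.1 : X →ₗ[𝕜] X), (ContinuousLinearMap.IsIdempotentElem.isTopCompl A.2.1).closedComplemented,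
    fun h => A.2.2.1 (ContinuousLinearMap.ext fun x =>
      (Submodule.eq_bot_iff _).1 h (A.1 x) ⟨x, rfl⟩),
    fun h => A.2.2.2 (ContinuousLinearMap.ext fun x => by
      obtain ⟨y, rfl⟩ := Submodule.eq_top_iff'.1 h x
      exact A.apply_apply y)⟩
  snd := ⟨LinearMap.ker (A.1 : X →ₗ[𝕜] X), (ContinuousLinearMap.IsIdempotentElem.isTopCompl A.2.1).symm.closedComplemented,
    fun h => A.2.2.2 (ContinuousLinearMap.ext fun x => by
      have : x - A.1 x ∈ LinearMap.ker (A.1 : X →ₗ[𝕜] X) := by simp [A.apply_apply]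
      exact (sub_eq_zero.1 ((Submodule.eq_bot_iff _).1 h _ this)).symm),
    fun h => A.2.2.1 (ContinuousLinearMap.ext fun x => Submodule.eq_top_iff'.1 h x)⟩
  isCompl := (ContinuousLinearMap.IsIdempotentElem.isTopCompl A.2.1).isCompl

theorem Idempotents.mem_toPair_fst {A : Idempotents 𝕜 X} {x : X} :
    x ∈ A.toPair.fst.toSubmodule ↔ A.1 x = x := by
  constructor
  · rintro ⟨y, rfl⟩
    exact A.apply_apply y
  · intro h
    exact ⟨x, h⟩

theorem Idempotents.toPair_fst_eq {A : Idempotents 𝕜 X} {E : BanachGrassmannian 𝕜 X}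
    (hA : A.1 ∈ E.idempotentsOnto) : A.toPair.fst = E :=
  BanachGrassmannian.ext (Submodule.ext fun x =>
    Idempotents.mem_toPair_fst.trans ⟨fun h => h ▸ hA.1 x, fun h => hA.2 x h⟩)

variable [CompleteSpace X]

namespace ComplementaryPair

theorem idempotent_apply (p : ComplementaryPair 𝕜 X) (x : X) : p.idempotent.1 x = p.fstProj x := rfl

theorem idempotent_mem (p : ComplementaryPair 𝕜 X) :
    p.idempotent.1 ∈ p.fst.idempotentsOnto :=
  ⟨fun x => (p.fstProj x).2, fun e he => congrArg Subtype.val (p.fstProj_fst ⟨e, he⟩)⟩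

@[simp] theorem toPair_idempotent (p : ComplementaryPair 𝕜 X) : p.idempotent.toPair = p :=
  ComplementaryPair.ext (BanachGrassmannian.ext p.range_ker_idempotent.1)
    (BanachGrassmannian.ext p.range_ker_idempotent.2)

end ComplementaryPair

@[simp] theorem Idempotents.idempotent_toPair (A : Idempotents 𝕜 X) : A.toPair.idempotent = A :=
  Subtype.ext (ContinuousLinearMap.IsIdempotentElem.eq_projectionL A.2.1).symm

open ComplementaryPair

/-- The range of an idempotent depends continuously on the idempotent. -/
theorem Idempotents.continuous_toPair_fst :
    Continuous fun A : Idempotents 𝕜 X => A.toPair.fst := by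
  refine continuous_iff_continuousAt.2 fun Q => ?_
  set p := Q.toPair with hp
  have hpQ : ∀ x, (p.fstProj x : X) = Q.1 x := fun x => by
    rw [← p.idempotent_apply, hp, Q.idempotent_toPair]
  have hQe : ∀ e : p.fst.toSubmodule, Q.1 e = e := fun e => Idempotents.mem_toPair_fst.1 e.2
  let V : Idempotents 𝕜 X → (p.fst.toSubmodule →L[𝕜] p.fst.toSubmodule) := fun A =>
    -- `V A` and `W A` are the components of `A` restricted to the range of `Q`. Once `V A` is
    -- invertible, the image of that restriction is the graph of `W A ∘L (V A).inverse`.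
    p.fstProj ∘L A.1 ∘L p.fst.toSubmodule.subtypeL
  let W : Idempotents 𝕜 X → (p.fst.toSubmodule →L[𝕜] p.snd.toSubmodule) := fun A =>
    p.sndProj ∘L A.1 ∘L p.fst.toSubmodule.subtypeL
  -- `U A` satisfies `A (U A) = A Q` and equals `1` at `A = Q`. Its invertibility nearby ensures
  -- that `A` maps the range of `Q` onto the whole range of `A`.
  let U : Idempotents 𝕜 X → (X →L[𝕜] X) := fun A => A.1 * Q.1 + (1 - A.1) * (1 - Q.1)
  have hV : Continuous V := by fun_prop
  have hW : Continuous W := by fun_prop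
  have hU : Continuous U := by fun_prop
  have hVQ : V Q = (ContinuousLinearEquiv.refl 𝕜 p.fst.toSubmodule :
      p.fst.toSubmodule →L[𝕜] p.fst.toSubmodule) := by
    ext e
    change (p.fstProj (Q.1 e) : X) = e
    rw [hQe, p.fstProj_fst]
  have hUQ : U Q = ((1 : (X →L[𝕜] X)ˣ) : X →L[𝕜] X) := by
    simp [U, mul_sub, sub_mul, Q.2.1.eq]
  have hVn : ∀ᶠ A in 𝓝 Q, V A ∈ range ContinuousLinearEquiv.toContinuousLinearMap :=
    hV.continuousAt.eventually_mem (by rw [hVQ]; exact ContinuousLinearEquiv.nhds _)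
  have hUn : ∀ᶠ A in 𝓝 Q, IsUnit (U A) :=
    hU.continuousAt.eventually_mem (s := {x | IsUnit x}) (by rw [hUQ]; exact Units.nhds _)
  have hT : ContinuousAt (fun A => W A ∘L (V A).inverse) Q := by
    refine ContinuousAt.clm_comp hW.continuousAt ?_
    refine ContinuousAt.comp (g := ContinuousLinearMap.inverse) ?_ hV.continuousAt
    rw [hVQ]
    exact (contDiffAt_map_inverse (𝕜 := 𝕜) (n := 0) _).continuousAt
  refine (p.continuous_graphMap.continuousAt.comp hT).congr ?_
  filter_upwards [hVn, hUn] with A ⟨e, he⟩ hA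
  have key : ∀ x : p.fst.toSubmodule, (e x : X) + (W A ∘L (V A).inverse) (e x) = A.1 x := by
    intro x
    have h1 : e x = p.fstProj (A.1 x) := DFunLike.congr_fun he x
    have h2 : (W A ∘L (V A).inverse) (e x) = p.sndProj (A.1 x) := by
      rw [← he, ContinuousLinearMap.inverse_equiv]
      simp [W]
    rw [h2, h1, p.fstProj_add_sndProj]
  refine BanachGrassmannian.ext (Submodule.ext fun x => ?_)
  change x ∈ p.graph _ ↔ _
  rw [mem_graph, Idempotents.mem_toPair_fst]
  constructor
  · rintro ⟨y, rfl⟩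
    obtain ⟨y, rfl⟩ := e.surjective y
    rw [key, A.apply_apply]
  · intro hx
    obtain ⟨u, hu⟩ := hA
    obtain ⟨y, rfl⟩ : ∃ y, U A y = x :=
      ⟨(↑u⁻¹ : X →L[𝕜] X) x, by
        rw [← hu, ← mul_apply_eq_comp, Units.mul_inv, one_apply_eq_self]⟩
    -- If `A` fixes `x = U A y`, then `x = A (U A y) = A (Q y)`, the image of a vector in the range
    -- of `Q`.
    refine ⟨e (p.fstProj y), (key _).trans ?_⟩
    rw [hpQ, ← hx]
    simp [U, A.apply_apply]

/-- The complementary idempotent `1 - A`. -/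
def Idempotents.compl (A : Idempotents 𝕜 X) : Idempotents 𝕜 X :=
  ⟨1 - A.1, A.2.1.one_sub, fun h => A.2.2.2 (sub_eq_zero.1 h).symm,
    fun h => A.2.2.1 (by simpa using h)⟩

omit [CompleteSpace X] in
theorem Idempotents.toPair_compl_fst (A : Idempotents 𝕜 X) : A.compl.toPair.fst = A.toPair.snd :=
  BanachGrassmannian.ext (Submodule.ext fun x => Idempotents.mem_toPair_fst.trans (by
    simp [Idempotents.compl, Idempotents.toPair]))

theorem Idempotents.continuous_toPair :
    Continuous (Idempotents.toPair : Idempotents 𝕜 X → ComplementaryPair 𝕜 X) := by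
  refine continuous_induced_rng.2 (Idempotents.continuous_toPair_fst.prodMk ?_)
  have h : Continuous (Idempotents.compl : Idempotents 𝕜 X → Idempotents 𝕜 X) :=
    continuous_induced_rng.2 (continuous_const.sub continuous_subtype_val)
  exact (Idempotents.continuous_toPair_fst.comp h).congr fun A => A.toPair_compl_fst

namespace ComplementaryPair

theorem continuous_toProd : Continuous fun p : ComplementaryPair 𝕜 X => (p.fst, p.snd) :=
  continuous_induced_dom

theorem continuous_fst :
    Continuous (ComplementaryPair.fst : ComplementaryPair 𝕜 X → BanachGrassmannian 𝕜 X) :=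
  _root_.continuous_fst.comp continuous_toProd

theorem continuous_snd :
    Continuous (ComplementaryPair.snd : ComplementaryPair 𝕜 X → BanachGrassmannian 𝕜 X) :=
  _root_.continuous_snd.comp continuous_toProd

/-! ### Shears, coordinates on pairs, and continuity of the idempotent -/

variable (p : ComplementaryPair 𝕜 X)

/-- The automorphism `I + T P` of `X`, with `P` the projection onto `E` along `F`, for `p = (E, F)`
and `T : E → F`. -/
def shear (T : p.fst.toSubmodule →L[𝕜] p.snd.toSubmodule) : X →L[𝕜] X :=
  1 + p.snd.toSubmodule.subtypeL ∘L T ∘L p.fstProj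

variable {p}

theorem shear_apply (T : p.fst.toSubmodule →L[𝕜] p.snd.toSubmodule) (x : X) :
    p.shear T x = x + T (p.fstProj x) := rfl

@[simp] theorem shear_shear_neg (T : p.fst.toSubmodule →L[𝕜] p.snd.toSubmodule) (x : X) :
    p.shear T (p.shear (-T) x) = x := by
  simp [shear_apply]

@[simp] theorem shear_neg_shear (T : p.fst.toSubmodule →L[𝕜] p.snd.toSubmodule) (x : X) :
    p.shear (-T) (p.shear T x) = x := by
  simp [shear_apply]

variable (p) in
@[simp] theorem shear_zero : p.shear 0 = 1 := by
  simp [shear]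

variable (p) in
@[fun_prop]
theorem contDiff_shear {n : WithTop ℕ∞} : ContDiff 𝕜 n p.shear :=
  contDiff_const.add (contDiff_const.clm_comp (contDiff_id.clm_comp contDiff_const))

theorem shear_mem {T : p.fst.toSubmodule →L[𝕜] p.snd.toSubmodule} {x : X}
    (hx : x ∈ p.fst.toSubmodule) : p.shear T x ∈ (p.graphMap T).toSubmodule := by
  refine (mem_graph _ _ _).2 ⟨⟨x, hx⟩, ?_⟩
  rw [shear_apply, show p.fstProj x = ⟨x, hx⟩ from p.fstProj_fst ⟨x, hx⟩]

theorem shear_neg_mem {T : p.fst.toSubmodule →L[𝕜] p.snd.toSubmodule} {x : X}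
    (hx : x ∈ (p.graphMap T).toSubmodule) : p.shear (-T) x ∈ p.fst.toSubmodule := by
  obtain ⟨e, rfl⟩ := (mem_graph _ _ _).1 hx
  simp [shear_apply]

/-- Conjugation of operators by `shear T`. -/
def shearConj (T : p.fst.toSubmodule →L[𝕜] p.snd.toSubmodule) :
    (X →L[𝕜] X) →L[𝕜] (X →L[𝕜] X) :=
  ContinuousLinearMap.compL 𝕜 X X X (p.shear T) ∘L
    (ContinuousLinearMap.compL 𝕜 X X X).flip (p.shear (-T))

@[simp] theorem shearConj_apply (T : p.fst.toSubmodule →L[𝕜] p.snd.toSubmodule)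
    (A : X →L[𝕜] X) (x : X) : shearConj T A x = p.shear T (A (p.shear (-T) x)) := rfl

theorem shearConj_shearConj_neg (T : p.fst.toSubmodule →L[𝕜] p.snd.toSubmodule)
    (A : X →L[𝕜] X) : shearConj T (shearConj (-T) A) = A := by
  ext x
  simp

theorem shearConj_neg_shearConj (T : p.fst.toSubmodule →L[𝕜] p.snd.toSubmodule)
    (A : X →L[𝕜] X) : shearConj (-T) (shearConj T A) = A := by
  ext x
  simp

variable (p) in
@[simp] theorem shearConj_zero (A : X →L[𝕜] X) :
    shearConj (0 : p.fst.toSubmodule →L[𝕜] p.snd.toSubmodule) A = A := by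
  ext x
  simp

theorem contDiff_shearConj {n : WithTop ℕ∞} :
    ContDiff 𝕜 n (shearConj : (p.fst.toSubmodule →L[𝕜] p.snd.toSubmodule) → _) := by
  have h1 := (ContinuousLinearMap.compL 𝕜 X X X).contDiff.comp (p.contDiff_shear (n := n))
  have h2 := (ContinuousLinearMap.compL 𝕜 X X X).flip.contDiff.comp
    ((p.contDiff_shear (n := n)).comp contDiff_neg)
  exact h1.clm_comp h2

/-- The shear maps `E` onto the graph of `T`, and conjugating by an automorphism transports ranges
and fixed vectors. -/
theorem shearConj_mem {T : p.fst.toSubmodule →L[𝕜] p.snd.toSubmodule} {A : X →L[𝕜] X}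
    (hA : A ∈ p.fst.idempotentsOnto) : shearConj T A ∈ (p.graphMap T).idempotentsOnto :=
  ⟨fun x => shear_mem (hA.1 _), fun e he => by
    rw [shearConj_apply, hA.2 _ (shear_neg_mem he), shear_shear_neg]⟩

theorem shearConj_neg_mem {T : p.fst.toSubmodule →L[𝕜] p.snd.toSubmodule} {A : X →L[𝕜] X}
    (hA : A ∈ (p.graphMap T).idempotentsOnto) : shearConj (-T) A ∈ p.fst.idempotentsOnto :=
  ⟨fun x => shear_neg_mem (hA.1 _), fun e he => by
    rw [shearConj_apply, neg_neg, hA.2 _ (shear_mem he), shear_neg_shear]⟩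

variable (p) in
/-- The lower left block `E ← F` of an operator, for `p = (E, F)`. -/
def block : (X →L[𝕜] X) →L[𝕜] (p.snd.toSubmodule →L[𝕜] p.fst.toSubmodule) :=
  (ContinuousLinearMap.compL 𝕜 p.snd.toSubmodule X p.fst.toSubmodule p.fstProj) ∘L
    (ContinuousLinearMap.compL 𝕜 p.snd.toSubmodule X X).flip p.snd.toSubmodule.subtypeL

variable (p) in
/-- The operator on `X` which extends `S : F → E` by zero on `E`, for `p = (E, F)`. -/
def extend : (p.snd.toSubmodule →L[𝕜] p.fst.toSubmodule) →L[𝕜] (X →L[𝕜] X) :=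
  (ContinuousLinearMap.compL 𝕜 X p.fst.toSubmodule X p.fst.toSubmodule.subtypeL) ∘L
    (ContinuousLinearMap.compL 𝕜 X p.snd.toSubmodule p.fst.toSubmodule).flip p.sndProj

@[simp] theorem block_apply (A : X →L[𝕜] X) (f : p.snd.toSubmodule) :
    p.block A f = p.fstProj (A f) := rfl

@[simp] theorem extend_apply (S : p.snd.toSubmodule →L[𝕜] p.fst.toSubmodule) (x : X) :
    p.extend S x = S (p.sndProj x) := rfl

@[simp] theorem block_extend (S : p.snd.toSubmodule →L[𝕜] p.fst.toSubmodule) :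
    p.block (p.extend S) = S := by
  ext f
  simp

variable (p) in
@[simp] theorem block_idempotent : p.block p.idempotent.1 = 0 := by
  ext f
  simp [idempotent_apply]

theorem idempotent_add_extend_mem (S : p.snd.toSubmodule →L[𝕜] p.fst.toSubmodule) :
    p.idempotent.1 + p.extend S ∈ p.fst.idempotentsOnto := by
  refine ⟨fun x => p.fst.toSubmodule.add_mem (p.fstProj x).2 (S (p.sndProj x)).2, fun e he => ?_⟩
  simp [p.idempotent_mem.2 e he, p.sndProj_eq_zero_iff.2 he]

/-- An idempotent onto `E` is the identity on `E`, so its restriction to `F`, a map `F → E`,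
determines it. -/
theorem idempotent_add_extend_block {A : X →L[𝕜] X} (hA : A ∈ p.fst.idempotentsOnto) :
    p.idempotent.1 + p.extend (p.block A) = A := by
  ext x
  have h1 : (p.fstProj (A (p.sndProj x)) : X) = A (p.sndProj x) :=
    congrArg Subtype.val (p.fstProj_fst ⟨_, hA.1 _⟩)
  have h2 : A (p.fstProj x) = p.fstProj x := hA.2 _ (p.fstProj x).2
  conv_rhs => rw [← p.fstProj_add_sndProj x, map_add, h2]
  simp [idempotent_apply, h1]

/-- The idempotent onto the graph of `T` with coordinate `S`. -/
def idempotentOfCoord (z : (p.fst.toSubmodule →L[𝕜] p.snd.toSubmodule) ×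
    (p.snd.toSubmodule →L[𝕜] p.fst.toSubmodule)) : Idempotents 𝕜 X :=
  ⟨shearConj z.1 (p.idempotent.1 + p.extend z.2),
    BanachGrassmannian.isIdempotentElem_of_mem (shearConj_mem (idempotent_add_extend_mem _))⟩

variable (p) in
/-- The coordinates `(T, S)` of a pair whose first member is the graph of `T`. -/
def pairCoord (r : ComplementaryPair 𝕜 X) : (p.fst.toSubmodule →L[𝕜] p.snd.toSubmodule) ×
    (p.snd.toSubmodule →L[𝕜] p.fst.toSubmodule) :=
  (p.coord r.fst, p.block (shearConj (-p.coord r.fst) r.idempotent.1))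

theorem idempotentOfCoord_toPair_fst (z : (p.fst.toSubmodule →L[𝕜] p.snd.toSubmodule) ×
    (p.snd.toSubmodule →L[𝕜] p.fst.toSubmodule)) :
    (idempotentOfCoord z).toPair.fst = p.graphMap z.1 :=
  Idempotents.toPair_fst_eq (shearConj_mem (idempotent_add_extend_mem _))

@[simp] theorem pairCoord_toPair (z : (p.fst.toSubmodule →L[𝕜] p.snd.toSubmodule) ×
    (p.snd.toSubmodule →L[𝕜] p.fst.toSubmodule)) :
    p.pairCoord (idempotentOfCoord z).toPair = z := by
  simp only [pairCoord, idempotentOfCoord_toPair_fst, coord_graphMap,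
    Idempotents.idempotent_toPair]
  simp [idempotentOfCoord, shearConj_neg_shearConj]

theorem toPair_pairCoord {r : ComplementaryPair 𝕜 X}
    (hr : IsCompl r.fst.toSubmodule p.snd.toSubmodule) :
    (idempotentOfCoord (p.pairCoord r)).toPair = r := by
  conv_rhs => rw [← r.toPair_idempotent]
  congr 1
  apply Subtype.ext
  have h := r.idempotent_mem
  have h1 : shearConj (-p.coord r.fst) r.idempotent.1 ∈ p.fst.idempotentsOnto :=
    shearConj_neg_mem (by rwa [graphMap_coord hr])
  simp only [idempotentOfCoord, pairCoord, idempotent_add_extend_block h1,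
    shearConj_shearConj_neg]

theorem contDiff_idempotentOfCoord {n : WithTop ℕ∞} :
    ContDiff 𝕜 n fun z : (p.fst.toSubmodule →L[𝕜] p.snd.toSubmodule) ×
      (p.snd.toSubmodule →L[𝕜] p.fst.toSubmodule) => (idempotentOfCoord z : X →L[𝕜] X) := by
  rw [contDiff_iff_contDiffAt]
  intro z
  have h : ContDiff 𝕜 n fun z : (p.fst.toSubmodule →L[𝕜] p.snd.toSubmodule) ×
      (p.snd.toSubmodule →L[𝕜] p.fst.toSubmodule) => p.idempotent.1 + p.extend z.2 :=
    contDiff_const.add (p.extend.contDiff.comp contDiff_snd)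
  exact (contDiff_shearConj.comp contDiff_fst).contDiffAt.clm_apply h.contDiffAt

/-- The pair with coordinates `(T, S)` varies continuously with `(T, S)`. -/
theorem continuous_toPair_idempotentOfCoord :
    Continuous fun z : (p.fst.toSubmodule →L[𝕜] p.snd.toSubmodule) ×
      (p.snd.toSubmodule →L[𝕜] p.fst.toSubmodule) => (idempotentOfCoord z).toPair :=
  Idempotents.continuous_toPair.comp
    (continuous_induced_rng.2 (contDiff_idempotentOfCoord (n := 0)).continuous)

theorem continuous_idempotent :
    Continuous (ComplementaryPair.idempotent : ComplementaryPair 𝕜 X → Idempotents 𝕜 X) := by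
  refine continuous_induced_rng.2 (continuous_iff_continuousAt.2 fun p => ?_)
  let S : ComplementaryPair 𝕜 X → (p.snd.toSubmodule →L[𝕜] p.fst.toSubmodule) := fun r =>
    p.swap.coord r.snd
  -- Near `p` the two members of `r` are graphs over those of `p`. `M r` carries the first member of
  -- `p` into that of `r` and the second into the second, and `M p = 1`.
  let M : ComplementaryPair 𝕜 X → (X →L[𝕜] X) := fun r =>
    p.shear (p.coord r.fst) + p.extend (S r)
  have hM : ContinuousAt M p := by
    have h1 : ContinuousAt (fun r : ComplementaryPair 𝕜 X => p.coord r.fst) p :=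
      ContinuousAt.comp (continuousAt_coord p.isCompl) continuous_fst.continuousAt
    have h2 : ContinuousAt S p :=
      ContinuousAt.comp (continuousAt_coord p.swap.isCompl) continuous_snd.continuousAt
    exact ((p.contDiff_shear (n := 0)).continuous.continuousAt.comp h1).add
      (p.extend.continuous.continuousAt.comp h2)
  have hMp : M p = ((1 : (X →L[𝕜] X)ˣ) : X →L[𝕜] X) := by
    have : S p = 0 := p.swap.coord_fst
    simp [M, this]
  have hU : ∀ᶠ r in 𝓝 p, IsUnit (M r) :=
    hM.eventually_mem (s := {x | IsUnit x}) (by rw [hMp]; exact Units.nhds _)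
  have hE : ∀ᶠ r : ComplementaryPair 𝕜 X in 𝓝 p, IsCompl r.fst.toSubmodule p.snd.toSubmodule :=
    continuous_fst.continuousAt.eventually_mem (p.isOpen_setOf_isCompl_snd.mem_nhds p.isCompl)
  have hF : ∀ᶠ r : ComplementaryPair 𝕜 X in 𝓝 p, IsCompl r.snd.toSubmodule p.fst.toSubmodule :=
    continuous_snd.continuousAt.eventually_mem
      (p.swap.isOpen_setOf_isCompl_snd.mem_nhds p.isCompl.symm)
  -- This product is the idempotent of `r` as soon as `M r` is invertible and intertwines the two
  -- idempotents. `Ring.inverse` is total and continuous at units.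
  have hinv : ContinuousAt (fun r => M r * p.idempotent.1 * Ring.inverse (M r)) p := by
    refine (hM.mul continuousAt_const).mul (ContinuousAt.comp (g := Ring.inverse) ?_ hM)
    rw [hMp]
    exact NormedRing.inverse_continuousAt _
  refine hinv.congr ?_
  filter_upwards [hU, hE, hF] with r hU hE hF
  have key : M r * p.idempotent.1 = r.idempotent.1 * M r := by
    ext x
    have hfst : ∀ e : p.fst.toSubmodule, r.idempotent.1 (e + p.coord r.fst e) =
        e + p.coord r.fst e := fun e => by
      refine r.idempotent_mem.2 _ ?_
      conv_lhs => rw [← graphMap_coord hE]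
      exact (mem_graph _ _ _).2 ⟨e, rfl⟩
    have hsnd : ∀ f : p.snd.toSubmodule, r.idempotent.1 (f + S r f) = 0 :=
        fun f => by
      have h : (f : X) + S r f ∈ r.snd.toSubmodule := by
        conv_lhs => rw [← graphMap_coord (p := p.swap) hF]
        exact (mem_graph _ _ _).2 ⟨f, rfl⟩
      rw [idempotent_apply, r.fstProj_eq_zero_iff.2 h, ZeroMemClass.coe_zero]
    have hx : M r x = ((p.fstProj x : X) + p.coord r.fst (p.fstProj x)) +
        ((p.sndProj x : X) + S r (p.sndProj x)) := by
      conv_lhs => rw [← p.fstProj_add_sndProj x]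
      simp [M, shear_apply]
      abel
    rw [mul_apply_eq_comp, mul_apply_eq_comp, hx, map_add, hfst, hsnd, add_zero, idempotent_apply]
    simp [M, shear_apply]
  rw [key, mul_assoc, Ring.mul_inverse_cancel _ hU, mul_one]
  rfl

variable (𝕜 X) in
/-- Pairs of complementary subspaces correspond homeomorphically to idempotents. -/
def idempotentHomeomorph : ComplementaryPair 𝕜 X ≃ₜ Idempotents 𝕜 X where
  toFun := ComplementaryPair.idempotent
  invFun := Idempotents.toPair
  left_inv p := p.toPair_idempotent
  right_inv A := A.idempotent_toPair
  continuous_toFun := continuous_idempotent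
  continuous_invFun := Idempotents.continuous_toPair

end ComplementaryPair

end Pairs

/-! ### The bundle of pairs of complementary subspaces over the Grassmannian -/

section Bundle

variable {𝕜 : Type*} [RCLike 𝕜] {X : Type*} [NormedAddCommGroup X] [NormedSpace 𝕜 X]
  [CompleteSpace X]

namespace ComplementaryPair

variable (p q : ComplementaryPair 𝕜 X)

/-- The chart `r ↦ (T, S)` on the set of pairs whose first member is a complement of `F`, for
`p = (E, F)`. -/
def pairChart : PartialEquiv (ComplementaryPair 𝕜 X)
    ((p.fst.toSubmodule →L[𝕜] p.snd.toSubmodule) ×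
      (p.snd.toSubmodule →L[𝕜] p.fst.toSubmodule)) where
  toFun := p.pairCoord
  invFun z := (idempotentOfCoord z).toPair
  source := {r | IsCompl r.fst.toSubmodule p.snd.toSubmodule}
  target := univ
  map_source' _ _ := mem_univ _
  map_target' z _ := by
    rw [mem_ofPred_eq, idempotentOfCoord_toPair_fst]
    exact p.isCompl_graph z.1
  left_inv' _ hr := toPair_pairCoord hr
  right_inv' z _ := pairCoord_toPair z

theorem isOpen_setOf_isCompl_fst :
    IsOpen {r : ComplementaryPair 𝕜 X | IsCompl r.fst.toSubmodule p.snd.toSubmodule} :=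
  p.isOpen_setOf_isCompl_snd.preimage continuous_fst

theorem continuousOn_pairCoord : ContinuousOn p.pairCoord
    {r : ComplementaryPair 𝕜 X | IsCompl r.fst.toSubmodule p.snd.toSubmodule} := by
  have h1 : ContinuousOn (fun r : ComplementaryPair 𝕜 X => p.coord r.fst)
      {r : ComplementaryPair 𝕜 X | IsCompl r.fst.toSubmodule p.snd.toSubmodule} :=
    p.continuousOn_coord.comp continuous_fst.continuousOn fun _ h => h
  have h2 : Continuous fun r : ComplementaryPair 𝕜 X => r.idempotent.1 :=
    continuous_subtype_val.comp continuous_idempotent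
  have h3 : ContinuousOn (fun r : ComplementaryPair 𝕜 X => shearConj (-p.coord r.fst))
      {r : ComplementaryPair 𝕜 X | IsCompl r.fst.toSubmodule p.snd.toSubmodule} :=
    (contDiff_shearConj (n := 0)).continuous.comp_continuousOn h1.neg
  exact h1.prodMk (p.block.continuous.comp_continuousOn (h3.clm_apply h2.continuousOn))

variable {p q}

/-- The first coordinate changes as in the Grassmannian; the second is a block of an idempotent
conjugated by shears that depend analytically on `z`. -/
theorem contDiffAt_pairCoord_toPair {n : WithTop ℕ∞}
    {z : (p.fst.toSubmodule →L[𝕜] p.snd.toSubmodule) ×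
      (p.snd.toSubmodule →L[𝕜] p.fst.toSubmodule)}
    (hz : IsCompl (p.graphMap z.1).toSubmodule q.snd.toSubmodule) :
    ContDiffAt 𝕜 n (fun z => q.pairCoord (idempotentOfCoord (p := p) z).toPair) z := by
  have h1 : ContDiffAt 𝕜 n (fun z : (p.fst.toSubmodule →L[𝕜] p.snd.toSubmodule) ×
      (p.snd.toSubmodule →L[𝕜] p.fst.toSubmodule) => q.coord (p.graphMap z.1)) z :=
    ContDiffAt.comp (g := fun T => q.coord (p.graphMap T)) z (contDiffAt_coord_graphMap hz)
      contDiffAt_fst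
  have h2 : ContDiffAt 𝕜 n (fun z : (p.fst.toSubmodule →L[𝕜] p.snd.toSubmodule) ×
      (p.snd.toSubmodule →L[𝕜] p.fst.toSubmodule) =>
        shearConj (-q.coord (p.graphMap z.1))) z :=
    ContDiffAt.comp z contDiff_shearConj.contDiffAt h1.neg
  have h3 := h1.prodMk (q.block.contDiff.contDiffAt.comp z
    (h2.clm_apply contDiff_idempotentOfCoord.contDiffAt))
  refine h3.congr_of_eventuallyEq (Filter.Eventually.of_forall fun z => ?_)
  simp only [pairCoord, idempotentOfCoord_toPair_fst, Idempotents.idempotent_toPair,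
    Function.comp_apply]

end ComplementaryPair

open ComplementaryPair

variable (𝕜 X) in
/-- The atlas of the manifold of pairs of complementary subspaces. -/
def pairAtlas : Set (BanachChart 𝕜 (ComplementaryPair 𝕜 X)) :=
  Set.range fun p : ComplementaryPair 𝕜 X =>
    ⟨(p.fst.toSubmodule →L[𝕜] p.snd.toSubmodule) × (p.snd.toSubmodule →L[𝕜] p.fst.toSubmodule),
      p.pairChart⟩

theorem isBanachManifold_pairAtlas : IsBanachManifold (pairAtlas 𝕜 X) where
  t2 := (idempotentHomeomorph 𝕜 X).symm.t2Space
  complete := by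
    rintro _ ⟨p, rfl⟩
    exact (inferInstance : CompleteSpace ((p.fst.toSubmodule →L[𝕜] p.snd.toSubmodule) ×
      (p.snd.toSubmodule →L[𝕜] p.fst.toSubmodule)))
  cover p := ⟨_, ⟨p, rfl⟩, p.isCompl⟩
  isOpen_source := by rintro _ ⟨p, rfl⟩; exact p.isOpen_setOf_isCompl_fst
  isOpen_target := by rintro _ ⟨p, rfl⟩; exact isOpen_univ
  continuousOn := by rintro _ ⟨p, rfl⟩; exact p.continuousOn_pairCoord
  continuousOn_symm := by
    rintro _ ⟨p, rfl⟩; exact continuous_toPair_idempotentOfCoord.continuousOn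
  analytic := by
    rintro _ ⟨p, rfl⟩ _ ⟨q, rfl⟩ z hz
    refine (contDiffAt_pairCoord_toPair (q := q) ?_).analyticAt
    have h : IsCompl (idempotentOfCoord z).toPair.fst.toSubmodule q.snd.toSubmodule := hz.2
    rwa [idempotentOfCoord_toPair_fst] at h

theorem isAnalyticOn_idempotent : IsAnalyticOn (pairAtlas 𝕜 X) (vectorAtlas 𝕜 (X →L[𝕜] X))
    (fun p : ComplementaryPair 𝕜 X => (p.idempotent : X →L[𝕜] X)) univ := by
  refine .of_exists_charts isBanachManifold_pairAtlas (isBanachManifold_vectorAtlas _)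
    fun p _ => ⟨_, ⟨p, rfl⟩, _, rfl, p.isCompl, Filter.Eventually.of_forall fun _ => mem_univ _, ?_⟩
  refine (contDiff_idempotentOfCoord (p := p)).contDiffAt.analyticAt.congr
    (Filter.Eventually.of_forall fun z => ?_)
  exact congrArg Subtype.val (idempotentOfCoord z).idempotent_toPair.symm

theorem isAnalyticOn_fst :
    IsAnalyticOn (pairAtlas 𝕜 X) (grassmannAtlas 𝕜 X) ComplementaryPair.fst univ := by
  refine .of_exists_charts isBanachManifold_pairAtlas isBanachManifold_grassmannAtlas
    fun p _ => ⟨_, ⟨p, rfl⟩, _, ⟨p, rfl⟩, p.isCompl,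
      p.isOpen_setOf_isCompl_fst.mem_nhds p.isCompl, ?_⟩
  refine AnalyticAt.congr (f := Prod.fst) analyticAt_fst (Filter.Eventually.of_forall fun z => ?_)
  exact (congrArg Prod.fst (pairCoord_toPair z)).symm

/-! ### The derivative of the map to idempotents -/

namespace ComplementaryPair

variable (p : ComplementaryPair 𝕜 X)

/-- The off-diagonal blocks of an operator, for the decomposition of `X` given by `p`. -/
def offDiag : (X →L[𝕜] X) →L[𝕜] (p.fst.toSubmodule →L[𝕜] p.snd.toSubmodule) ×
    (p.snd.toSubmodule →L[𝕜] p.fst.toSubmodule) :=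
  ContinuousLinearMap.prod p.swap.block p.block

theorem offDiag_idempotentOfCoord (z : (p.fst.toSubmodule →L[𝕜] p.snd.toSubmodule) ×
    (p.snd.toSubmodule →L[𝕜] p.fst.toSubmodule)) :
    p.offDiag (idempotentOfCoord z).1 = (z.1 - (z.1 ∘L z.2) ∘L z.1, z.2) := by
  refine Prod.ext (ContinuousLinearMap.ext fun e => ?_) (ContinuousLinearMap.ext fun f => ?_)
  · change p.sndProj (shearConj z.1 (p.idempotent.1 + p.extend z.2) (e : X)) = _
    simp [shear_apply, idempotent_apply]
    abel
  · change p.fstProj (shearConj z.1 (p.idempotent.1 + p.extend z.2) (f : X)) = _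
    simp [shear_apply, idempotent_apply]

/-- In `(T - T S T, S)` the cubic term has zero derivative at the origin. -/
theorem offDiag_comp_fderiv :
    p.offDiag ∘L fderiv 𝕜 (fun z : (p.fst.toSubmodule →L[𝕜] p.snd.toSubmodule) ×
      (p.snd.toSubmodule →L[𝕜] p.fst.toSubmodule) => (idempotentOfCoord z : X →L[𝕜] X)) 0 =
      ContinuousLinearMap.id 𝕜 _ := by
  have h1 := p.offDiag.hasFDerivAt.comp
    (0 : (p.fst.toSubmodule →L[𝕜] p.snd.toSubmodule) ×
      (p.snd.toSubmodule →L[𝕜] p.fst.toSubmodule))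
    ((contDiff_idempotentOfCoord (p := p) (n := 1)).differentiable (by simp) 0).hasFDerivAt
  have hf : HasFDerivAt (𝕜 := 𝕜) Prod.fst (ContinuousLinearMap.fst 𝕜 _ _)
    (0 : (p.fst.toSubmodule →L[𝕜] p.snd.toSubmodule) ×
      (p.snd.toSubmodule →L[𝕜] p.fst.toSubmodule)) := hasFDerivAt_fst
  have hs : HasFDerivAt (𝕜 := 𝕜) Prod.snd (ContinuousLinearMap.snd 𝕜 _ _)
    (0 : (p.fst.toSubmodule →L[𝕜] p.snd.toSubmodule) ×
      (p.snd.toSubmodule →L[𝕜] p.fst.toSubmodule)) := hasFDerivAt_snd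
  have h2 := (hf.sub ((hf.clm_comp hs).clm_comp hf)).prodMk hs
  have h3 := h2.congr_of_eventuallyEq (f := _) (Filter.Eventually.of_forall
    p.offDiag_idempotentOfCoord)
  rw [h1.unique h3]
  ext z <;> simp

end ComplementaryPair

theorem isAnalyticImmersion_idempotent : IsAnalyticImmersion (pairAtlas 𝕜 X)
    (fun p : ComplementaryPair 𝕜 X => (p.idempotent : X →L[𝕜] X)) := by
  refine ⟨isAnalyticOn_idempotent, fun p => ⟨_, ⟨p, rfl⟩, p.isCompl, ?_⟩⟩
  -- In its own chart `p` is the origin, so only the derivative at `0` is needed.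
  have h0 : p.pairCoord p = 0 := by
    simp [pairCoord, Prod.ext_iff]
  have hf : (fun z => ((idempotentOfCoord (p := p) z).toPair.idempotent : X →L[𝕜] X)) =
      fun z => (idempotentOfCoord (p := p) z : X →L[𝕜] X) :=
    funext fun z => congrArg Subtype.val (idempotentOfCoord z).idempotent_toPair
  have hinv := p.offDiag_comp_fderiv
  rw [← hf, ← h0] at hinv
  have hleft := fun z => DFunLike.congr_fun hinv z
  -- A bounded left inverse gives both injectivity and a bounded projection onto the range.
  exact ⟨Function.LeftInverse.injective (g := p.offDiag) hleft,
    ContinuousLinearMap.closedComplemented_range_of_leftInverse _ p.offDiag hleft⟩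

/-- The idempotents with range `E` form an affine-Banach subspace of `𝓛(X)`. -/
def BanachGrassmannian.fiber (E : BanachGrassmannian 𝕜 X) :
    AffineBanachSubspace 𝕜 (X →L[𝕜] X) where
  space := E.idempotentsOnto
  nonempty := ⟨⟨E.pair.idempotent.1, E.pair.idempotent_mem⟩⟩
  isClosed := by
    have hE : IsClosed (E.toSubmodule : Set X) := E.closedComplemented.isClosed
    have h : (E.idempotentsOnto : Set (X →L[𝕜] X)) =
        (⋂ x, {A | A x ∈ E.toSubmodule}) ∩ ⋂ e ∈ E.toSubmodule, {A | A e = e} := by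
      ext A
      simp [BanachGrassmannian.mem_idempotentsOnto]
    rw [h]
    refine (isClosed_iInter fun x => hE.preimage (by fun_prop)).inter
      (isClosed_biInter fun e _ => isClosed_eq (by fun_prop) continuous_const)

theorem ComplementaryPair.idempotent_mem_of_fst_eq {p : ComplementaryPair 𝕜 X}
    {E : BanachGrassmannian 𝕜 X} (h : p.fst = E) : p.idempotent.1 ∈ E.idempotentsOnto :=
  h ▸ p.idempotent_mem

/-- The pairs with first member `E` correspond homeomorphically to the idempotents with
range `E`. -/
def BanachGrassmannian.fiberHomeomorph (E : BanachGrassmannian 𝕜 X) :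
    ((ComplementaryPair.fst : ComplementaryPair 𝕜 X → BanachGrassmannian 𝕜 X) ⁻¹' {E}) ≃ₜ
      E.fiber.space where
  toFun p := ⟨p.1.idempotent.1, idempotent_mem_of_fst_eq p.2⟩
  invFun A := ⟨Idempotents.toPair ⟨A.1, BanachGrassmannian.isIdempotentElem_of_mem A.2⟩,
    Idempotents.toPair_fst_eq A.2⟩
  left_inv p := Subtype.ext p.1.toPair_idempotent
  right_inv A := by
    have h := congrArg Subtype.val (Idempotents.idempotent_toPair
      ⟨A.1, BanachGrassmannian.isIdempotentElem_of_mem A.2⟩)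
    exact Subtype.ext h
  continuous_toFun := by
    refine Continuous.subtype_mk ?_ _
    exact continuous_subtype_val.comp (continuous_idempotent.comp continuous_subtype_val)
  continuous_invFun := by
    refine Continuous.subtype_mk (Idempotents.continuous_toPair.comp ?_) _
    exact Continuous.subtype_mk continuous_subtype_val _

variable (𝕜 X) in
/-- The fibers of `(E, F) ↦ E`, as affine-Banach subspaces of `𝓛(X)`. -/
def pairFibers : AffineBanachFibers 𝕜 (fun _ : BanachGrassmannian 𝕜 X => X →L[𝕜] X)
    (ComplementaryPair.fst : ComplementaryPair 𝕜 X → BanachGrassmannian 𝕜 X) where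
  fiber := BanachGrassmannian.fiber
  homeo := BanachGrassmannian.fiberHomeomorph

/-! ### Local trivializations and their transition maps -/

namespace ComplementaryPair

variable (p q : ComplementaryPair 𝕜 X)

/-- The local trivialization of the bundle of pairs, over the set of complements of `F`, for
`p = (E, F)`. -/
def trivialization :
    OpenPartialHomeomorph (BanachGrassmannian 𝕜 X × p.fst.fiber.space) (ComplementaryPair 𝕜 X) where
  toFun z := (idempotentOfCoord (p.coord z.1, p.block z.2.1)).toPair
  invFun r := (r.fst, ⟨p.idempotent.1 + p.extend (p.pairCoord r).2, idempotent_add_extend_mem _⟩)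
  source := {E | IsCompl E.toSubmodule p.snd.toSubmodule} ×ˢ univ
  target := ComplementaryPair.fst ⁻¹' {E | IsCompl E.toSubmodule p.snd.toSubmodule}
  map_source' := by
    rintro ⟨E, A⟩ -
    rw [mem_preimage, idempotentOfCoord_toPair_fst]
    exact p.isCompl_graph _
  map_target' r hr := by
    refine mk_mem_prod ?_ (mem_univ _)
    exact hr
  left_inv' := by
    rintro ⟨E, A⟩ ⟨hE, -⟩
    refine Prod.ext ?_ (Subtype.ext ?_)
    · exact (idempotentOfCoord_toPair_fst _).trans (graphMap_coord hE)
    · simp only [pairCoord_toPair]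
      exact idempotent_add_extend_block A.2
  right_inv' := by
    intro r hr
    simp only [map_add, block_idempotent, zero_add, block_extend]
    exact toPair_pairCoord hr
  open_source := p.isOpen_setOf_isCompl_snd.prod isOpen_univ
  open_target := p.isOpen_setOf_isCompl_fst
  continuousOn_toFun := by
    refine continuous_toPair_idempotentOfCoord.comp_continuousOn (ContinuousOn.prodMk ?_ ?_)
    · exact p.continuousOn_coord.comp _root_.continuous_fst.continuousOn fun z hz => hz.1
    · exact (p.block.continuous.comp
        (continuous_subtype_val.comp _root_.continuous_snd)).continuousOn
  continuousOn_invFun := by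
    refine continuous_fst.continuousOn.prodMk (IsInducing.subtypeVal.continuousOn_iff.2 ?_)
    exact continuousOn_const.add
      (p.extend.continuous.comp_continuousOn p.continuousOn_pairCoord.snd)

/-- `extend`, with values in the direction of the space of idempotents with range `E`. -/
def extendDirection : (p.snd.toSubmodule →L[𝕜] p.fst.toSubmodule) →L[𝕜]
    p.fst.fiber.space.direction :=
  p.extend.codRestrict _ fun S => by
    simpa using p.fst.fiber.space.vsub_mem_direction (idempotent_add_extend_mem S)
      p.idempotent_mem

/-- In the charts given by `p` and the base point `A`, the trivialization reads `(T, D) ↦ (T,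
p.block (D + A))`, a continuous affine map. -/
theorem isAnalyticOn_trivialization :
    IsAnalyticOn (prodAtlas (grassmannAtlas 𝕜 X) (affineAtlas p.fst.fiber)) (pairAtlas 𝕜 X)
      p.trivialization p.trivialization.source := by
  refine .of_exists_charts (isBanachManifold_grassmannAtlas.prod (isBanachManifold_affineAtlas _))
    isBanachManifold_pairAtlas ?_
  rintro ⟨E, A⟩ ⟨hE, -⟩
  refine ⟨_, ⟨_, ⟨p, rfl⟩, _, ⟨A, rfl⟩, rfl⟩, _, ⟨p, rfl⟩, ⟨hE, mem_univ _⟩,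
    Filter.Eventually.of_forall fun z => ?_, ?_⟩
  · exact (p.pairChart).map_target (mem_univ _)
  · have h : ContDiff 𝕜 ⊤ fun z : (p.fst.toSubmodule →L[𝕜] p.snd.toSubmodule) ×
        p.fst.fiber.space.direction => (z.1, p.block (z.2 + A.1)) :=
      contDiff_fst.prodMk (p.block.contDiff.comp
        ((p.fst.fiber.space.direction.subtypeL.contDiff.comp contDiff_snd).add contDiff_const))
    refine h.contDiffAt.analyticAt.congr (Filter.Eventually.of_forall fun z => ?_)
    refine Eq.trans ?_ (pairCoord_toPair _).symm
    exact congrArg (fun T => (T, p.block (z.2 + A.1))) (coord_graphMap z.1).symm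

/-- With `Q_E^F` as base point of the fiber, the inverse reads `(T, S) ↦ (T, p.extend S)`, which is
linear. -/
theorem isAnalyticOn_trivialization_symm :
    IsAnalyticOn (pairAtlas 𝕜 X) (prodAtlas (grassmannAtlas 𝕜 X) (affineAtlas p.fst.fiber))
      p.trivialization.symm p.trivialization.target := by
  refine .of_exists_charts isBanachManifold_pairAtlas
    (isBanachManifold_grassmannAtlas.prod (isBanachManifold_affineAtlas _)) ?_
  intro r hr
  let A₀ : p.fst.fiber.space := ⟨p.idempotent.1, p.idempotent_mem⟩
  refine ⟨_, ⟨p, rfl⟩, _, ⟨_, ⟨p, rfl⟩, _, ⟨A₀, rfl⟩, rfl⟩, hr, ?_, ?_⟩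
  · filter_upwards [p.isOpen_setOf_isCompl_fst.mem_nhds hr] with r' hr'
    exact ⟨hr', mem_univ _⟩
  · have h : ContDiff 𝕜 ⊤ fun z : (p.fst.toSubmodule →L[𝕜] p.snd.toSubmodule) ×
        (p.snd.toSubmodule →L[𝕜] p.fst.toSubmodule) => (z.1, p.extendDirection z.2) :=
      contDiff_fst.prodMk (p.extendDirection.contDiff.comp contDiff_snd)
    refine h.contDiffAt.analyticAt.congr (Filter.Eventually.of_forall fun z => ?_)
    refine Prod.ext ?_ (Subtype.ext ?_)
    · exact (congrArg Prod.fst (pairCoord_toPair z)).symm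
    · change p.extend z.2 = p.idempotent.1 +
        p.extend (p.pairCoord (idempotentOfCoord z).toPair).2 - p.idempotent.1
      rw [pairCoord_toPair]
      abel

theorem trivialization_apply (z : BanachGrassmannian 𝕜 X × p.fst.fiber.space) :
    p.trivialization z = Idempotents.toPair ⟨shearConj (p.coord z.1) z.2.1,
      BanachGrassmannian.isIdempotentElem_of_mem (shearConj_mem z.2.2)⟩ := by
  change (idempotentOfCoord _).toPair = _
  congr 1
  apply Subtype.ext
  simp only [idempotentOfCoord]
  rw [idempotent_add_extend_block z.2.2]

/-- On a fiber the trivialization is conjugation by a fixed shear, the restriction of a linear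
operator on `𝓛(X)`, hence affine. -/
theorem exists_affineMap_trivialization {E : BanachGrassmannian 𝕜 X}
    (hE : IsCompl E.toSubmodule p.snd.toSubmodule) :
    ∃ g : p.fst.fiber.space →ᵃ[𝕜] E.fiber.space,
      ∀ A, p.trivialization (E, A) = (E.fiberHomeomorph.symm (g A) : ComplementaryPair 𝕜 X) := by
  have h : p.fst.fiber.space.map (shearConj (p.coord E) : (X →L[𝕜] X) →ₗ[𝕜] _).toAffineMap ≤
      E.fiber.space := by
    rintro _ ⟨A, hA, rfl⟩
    have h1 := shearConj_mem (T := p.coord E) hA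
    rwa [graphMap_coord hE] at h1
  exact ⟨AffineMap.restrict _ h, fun A => p.trivialization_apply (E, A)⟩

/-- The linear part of the transition map from the trivialization of `p` to that of `q`, over
the graph of `T`, as an operator on `𝓛(X)`. -/
def transitionLinear (E : BanachGrassmannian 𝕜 X) :
    (X →L[𝕜] X) →L[𝕜] q.fst.fiber.space.direction :=
  q.extendDirection ∘L q.block ∘L shearConj (-q.coord E) ∘L shearConj (p.coord E)

/-- The transition map from the trivialization of `p` to that of `q`. -/
def transition (E : BanachGrassmannian 𝕜 X) : p.fst.fiber.space →ᴬ[𝕜] q.fst.fiber.space where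
  toFun A := transitionLinear p q E A.1 +ᵥ ⟨q.idempotent.1, q.idempotent_mem⟩
  linear := (transitionLinear p q E ∘L p.fst.fiber.space.direction.subtypeL : _ →L[𝕜] _)
  map_vadd' A D := by
    rw [vadd_vadd]
    congr 1
    exact map_add (transitionLinear p q E) (D : X →L[𝕜] X) (A : X →L[𝕜] X)
  cont := ((continuous_subtype_val.comp ((transitionLinear p q E).continuous.comp
    continuous_subtype_val)).add continuous_const).subtype_mk _

/-- The map sends `A` over `E` to the actual idempotent by the shear of `p`, then undoes the shear
of `q`. Since an idempotent onto `q.fst` is recovered from its block, the result has the form of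
base point plus `extend` of a block. -/
theorem transition_apply {E : BanachGrassmannian 𝕜 X}
    (hE : IsCompl E.toSubmodule p.snd.toSubmodule) (A : p.fst.fiber.space) :
    transition p q E A = (q.trivialization.symm (p.trivialization (E, A))).2 := by
  have h : (p.trivialization (E, A)).fst = E :=
    (idempotentOfCoord_toPair_fst _).trans (graphMap_coord hE)
  apply Subtype.ext
  change q.extend (q.block (shearConj (-q.coord E) (shearConj (p.coord E) A.1))) + q.idempotent.1 =
    q.idempotent.1 + q.extend (q.block (shearConj (-q.coord (p.trivialization (E, A)).fst)
      (p.trivialization (E, A)).idempotent.1))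
  rw [h, trivialization_apply, Idempotents.idempotent_toPair, add_comm]

/-- Only `transitionLinear` varies with `E`, the base point being fixed, so both coordinates of the
affine map come from one analytic operator-valued function: a composition of conjugations by shears.
-/
theorem isAnalyticOn_affineMapCoord_transition (A₀ : p.fst.fiber.space) (B₀ : q.fst.fiber.space) :
    IsAnalyticOn (grassmannAtlas 𝕜 X) (vectorAtlas 𝕜 _)
      (fun E => affineMapCoord A₀ B₀ (transition p q E))
      ({E | IsCompl E.toSubmodule p.snd.toSubmodule} ∩
        {E | IsCompl E.toSubmodule q.snd.toSubmodule}) := by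
  have := q.fst.fiber.isClosed_direction.completeSpace_coe
  refine .of_exists_charts isBanachManifold_grassmannAtlas (isBanachManifold_vectorAtlas _) ?_
  rintro E ⟨hp, hq⟩
  refine ⟨_, ⟨p, rfl⟩, _, rfl, hp, Filter.Eventually.of_forall fun _ => mem_univ _, ?_⟩
  have hL : ContDiffAt 𝕜 ⊤ (fun T => transitionLinear p q (p.graphMap T)) (p.coord E) := by
    have h1 : ContDiffAt 𝕜 ⊤ (fun T => q.coord (p.graphMap T)) (p.coord E) :=
      contDiffAt_coord_graphMap (by rwa [graphMap_coord hp])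
    have h2 : ContDiffAt 𝕜 ⊤ (fun T => shearConj (-q.coord (p.graphMap T))) (p.coord E) :=
      contDiff_shearConj.contDiffAt.comp _ h1.neg
    have h3 : ContDiffAt 𝕜 ⊤ (fun T => shearConj (p := p) (p.coord (p.graphMap T)))
        (p.coord E) := by
      simpa only [coord_graphMap] using contDiff_shearConj.contDiffAt
    exact contDiffAt_const.clm_comp (contDiffAt_const.clm_comp (h2.clm_comp h3))
  have hc : ContDiffAt 𝕜 ⊤ (fun T => (transitionLinear p q (p.graphMap T) A₀.1 +
      ((⟨q.idempotent.1, q.idempotent_mem⟩ : q.fst.fiber.space) -ᵥ B₀),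
      transitionLinear p q (p.graphMap T) ∘L p.fst.fiber.space.direction.subtypeL))
      (p.coord E) :=
    ((hL.clm_apply contDiffAt_const).add contDiffAt_const).prodMk
      (hL.clm_comp contDiffAt_const)
  refine hc.analyticAt.congr (Filter.Eventually.of_forall fun T => ?_)
  exact Prod.ext (vadd_vsub_assoc _ _ _).symm rfl

end ComplementaryPair

/-- `(E, F) ↦ E` is a locally trivial analytic affine-Banach bundle. -/
theorem isAnalyticAffineBanachBundle_fst :
    IsAnalyticAffineBanachBundle (pairAtlas 𝕜 X) (grassmannAtlas 𝕜 X) ComplementaryPair.fst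
      (pairFibers 𝕜 X) where
  total := isBanachManifold_pairAtlas
  base := isBanachManifold_grassmannAtlas
  surjective := BanachGrassmannian.exists_pair
  analytic := isAnalyticOn_fst
  complete _ := inferInstance
  locallyTrivial := by
    refine ⟨fun E => {E' | IsCompl E'.toSubmodule E.pair.snd.toSubmodule},
      fun E => E.pair.trivialization, fun E => ⟨E.pair.isOpen_setOf_isCompl_snd, E.pair.isCompl,
        rfl, rfl, E.pair.isAnalyticOn_trivialization, E.pair.isAnalyticOn_trivialization_symm,
        fun E' hE' => E.pair.exists_affineMap_trivialization hE'⟩, fun E₁ E₂ =>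
      ⟨transition E₁.pair E₂.pair, fun E hE A => transition_apply _ _ hE.1 A,
        isAnalyticOn_affineMapCoord_transition E₁.pair E₂.pair⟩⟩

end Bundle

end

theorem mainTheorem6 {𝕜 : Type u} [RCLike 𝕜] {X : Type v} [NormedAddCommGroup X]
    [NormedSpace 𝕜 X] [CompleteSpace X] :
    IsHomeomorph (ComplementaryPair.idempotent : ComplementaryPair 𝕜 X → Idempotents 𝕜 X) ∧
    ∃ (A : Set (BanachChart.{u, v, v} 𝕜 (ComplementaryPair 𝕜 X)))
      (S : AffineBanachFibers 𝕜 (fun _ : BanachGrassmannian 𝕜 X => X →L[𝕜] X)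
        (ComplementaryPair.fst : ComplementaryPair 𝕜 X → BanachGrassmannian 𝕜 X)),
      IsAnalyticImmersion A (fun p : ComplementaryPair 𝕜 X => (p.idempotent : X →L[𝕜] X)) ∧
      (∀ (E : BanachGrassmannian 𝕜 X) (p : ComplementaryPair 𝕜 X) (hp : p.fst = E),
        (S.homeo E ⟨p, hp⟩ : X →L[𝕜] X) = p.idempotent) ∧
      IsAnalyticAffineBanachBundle A (grassmannAtlas 𝕜 X) ComplementaryPair.fst S := by
  exact ⟨(ComplementaryPair.idempotentHomeomorph 𝕜 X).isHomeomorph, pairAtlas 𝕜 X, pairFibers 𝕜 X,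
    isAnalyticImmersion_idempotent, fun E p hp => rfl, isAnalyticAffineBanachBundle_fst⟩
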